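/- **Setting.** Let $H$ and $\widetilde H$ be self-adjoint non-negative (possibly unbounded) operators in complex Hilbert spaces $\mathcal H$ and $\widetilde{\mathcal H}$, with resolvents $R=(H+1)^{-1}$, $\widetilde R=(\widetilde H+1)^{-1}$. For $k\ge 0$ put $\mathcal H_k=\operatorname{dom}(H+1)^{k/2}$, $\|f\|_k=\|(H+1)^{k/2}f\|$, and let $\mathfrak h(f,g)=\langle H^{1/2}f,H^{1/2}g\rangle$ for $f,g\in\mathcal H_1$; define $\widetilde{\mathcal H}_k$, $\|\cdot\|_k$, $\widetilde{\mathfrak h}$ in the same way from $\widetilde H$. For an operator $A$ defined on $\mathcal H_m$, $\|A\|_{m\to0}$ is the smallest $c$ with $\|Af\|\le c\|f\|_m$ for all $f\in\mathcal H_m$. Bounded measurable functions of $H$, $\widetilde H$ are defined by the Borel functional calculus. For $\delta>0$ and real $k\ge1$, the pairs $(H,\mathcal H)$ and $(\widetilde H,\widetilde{\mathcal H})$ are called *$\delta$-close of order $k$* with respect to linear maps $J:\mathcal H\to\widetilde{\mathcal H}$, $J':\widetilde{\mathcal H}\to\mathcal H$, $J_1:\mathcal H_1\to\widetilde{\mathcal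 H}_1$, $J_1':\widetilde{\mathcal H}_1\to\mathcal H_1$ if for all $f,u$ in the appropriate spaces $$\|Jf-J_1f\|\le\delta\|f\|_1,\quad \|J'u-J_1'u\|\le\delta\|u\|_1,\quad \|J-J'^*\|\le\delta,$$ $$|\widetilde{\mathfrak h}(J_1f,u)-\mathfrak h(f,J_1'u)|\le\delta\|f\|_k\|u\|_1,$$ $$\|f-J'Jf\|\le\delta\|f\|_1,\quad \|u-JJ'u\|\le\delta\|u\|_1,\quad \|J\|\le2,\quad\|J'\|\le2 .$$ Put $m=\max\{0,k-2\}$. **Theorem.** Let $U\subset[0,\infty]$ and let $\psi:[0,\infty]\to\mathbb C$ be bounded and measurable, continuous at every point of $U$, and such that $\lim_{\lambda\to\infty}\psi(\lambda)$ exists. Let $S\subset[0,\infty)$ be closed with $S\subset U$ (for instance, $S=\operatorname{spec}H$ for a given $H$ with $\operatorname{spec}H\subset U$). Then there is a function $\eta=\eta_{\psi,S}$ with $\eta(\delta)\to0$ as $\delta\to0^+$ such that $$\|\psi(\widetilde H)J-J\psi(H)\|_{m\to0}\le\eta(\delta)$$ for all $\delta>0$, all real $k\ge1$, and all pairs $(H,\mathcal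 H)$, $(\widetilde H,\widetilde{\mathcal H})$ that are $\delta$-close of order $k$ with respect to some $(J,J_1)$, $(J',J_1')$ and satisfy $\operatorname{spec}H\subset S$ or $\operatorname{spec}\widetilde H\subset S$. In particular, let $I\subset[0,\infty)$ be an interval and $S\subset[0,\infty)$ a closed set with $\partial I\cap S=\emptyset$, where $\partial I$ is the boundary of $I$ relative to $[0,\infty)$. Then there is a function $\eta=\eta_{I,S}$ with $\eta(\delta)\to0$ as $\delta\to0^+$ such that $$\|\mathbf 1_I(\widetilde H)J-J\mathbf 1_I(H)\|_{m\to0}\le\eta(\delta)$$ for all $\delta>0$, $k\ge 1$ and all such pairs which are $\delta$-close of order $k$ and satisfy $\operatorname{spec}H\subset S$ or $\operatorname{spec}\widetilde H\subset S$. -/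

import Mathlib

open Set Filter Topology MeasureTheory
open scoped NNReal ENNReal InnerProductSpace CompactlySupported

universe u v

noncomputable section

namespace QuasiUnitary

variable {E : Type*} [NormedAddCommGroup E] [InnerProductSpace ℂ E] [CompleteSpace E]
variable {F : Type*} [NormedAddCommGroup F] [InnerProductSpace ℂ F] [CompleteSpace F]

/-- A (possibly unbounded, densely defined) self-adjoint non-negative operator. -/
structure IsNonnegSelfAdjoint (H : E →ₗ.[ℂ] E) : Prop where
  selfAdjoint : IsSelfAdjoint H
  nonneg : ∀ x : H.domain, 0 ≤ (⟪(x : E), H x⟫_ℂ).re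

/-- The bounded operator `R` is the two-sided inverse of `A - z : dom A → E`. -/
def IsResolventAt (A : E →ₗ.[ℂ] E) (z : ℂ) (R : E →L[ℂ] E) : Prop :=
  (∀ x : A.domain, R (A x - z • (x : E)) = x) ∧
    ∀ f : E, ∃ x : A.domain, (x : E) = R f ∧ A x - z • (x : E) = f

/-- The spectrum of a (possibly unbounded) operator: the set of all `z` for which `A - z` has no
bounded everywhere defined inverse. -/
def spec (A : E →ₗ.[ℂ] E) : Set ℂ :=
  {z | ¬ ∃ R : E →L[ℂ] E, IsResolventAt A z R}

open Classical in
/-- The resolvent `R = (H + 1)⁻¹`. It is unique, and it exists for every non-negative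
self-adjoint `H`; in all other cases the value is `0`. -/
def resolvent (H : E →ₗ.[ℂ] E) : E →L[ℂ] E :=
  if h : ∃ R : E →L[ℂ] E, IsResolventAt H (-1) R then h.choose else 0

/-- The operator `(H + 1) ^ (k / 2)` for `k ≥ 0`, as the (in general unbounded) inverse of the
bounded injective operator `R ^ (k / 2)`. -/
def shiftPow (H : E →ₗ.[ℂ] E) (k : ℝ) : E →ₗ.[ℂ] E :=
  (LinearMap.toPMap ((resolvent H ^ (k / 2) : E →L[ℂ] E) : E →ₗ[ℂ] E) ⊤).inverse

/-- The space of order `k ≥ 0` in the scale of Hilbert spaces: `dom (H + 1) ^ (k / 2)`. -/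
def scale (H : E →ₗ.[ℂ] E) (k : ℝ) : Submodule ℂ E := (shiftPow H k).domain

/-- The norm `‖f‖_k = ‖(H + 1) ^ (k / 2) f‖` of the scale of Hilbert spaces. -/
def scaleNorm (H : E →ₗ.[ℂ] E) (k : ℝ) (f : scale H k) : ℝ := ‖shiftPow H k f‖

/-- The closed sesquilinear form `h` of `H` with form domain `dom (H + 1) ^ (1 / 2)`. The
polarized identity `‖H ^ (1 / 2) f‖² = ‖(H + 1) ^ (1 / 2) f‖² - ‖f‖²` is used. -/
def form (H : E →ₗ.[ℂ] E) (f g : scale H 1) : ℂ :=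
  ⟪shiftPow H 1 f, shiftPow H 1 g⟫_ℂ - ⟪(f : E), (g : E)⟫_ℂ

/-- The positive functional `φ ↦ ⟪f, φ(R) f⟫` given by the continuous functional calculus of a
bounded self-adjoint operator `R`. -/
def cfcFunctional (R : E →L[ℂ] E) (f : E) : C_c(ℝ, ℝ) →ₚ[ℝ] ℝ :=
  PositiveLinearMap.mk₀
    { toFun := fun φ => (⟪f, (cfc (fun t => φ t) R : E →L[ℂ] E) f⟫_ℂ).re
      map_add' := fun φ χ => by
        have h : cfc (fun t => (φ + χ) t) R = cfc (fun t => φ t) R + cfc (fun t => χ t) R :=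
          cfc_add R (fun t => φ t) (fun t => χ t) φ.continuous.continuousOn χ.continuous.continuousOn
        rw [h]
        simp
      map_smul' := fun c φ => by
        have h : cfc (fun t => (c • φ) t) R = c • cfc (fun t => φ t) R :=
          cfc_smul c (fun t => φ t) R φ.continuous.continuousOn
        rw [h]
        simp [inner_smul_right_eq_smul] }
    (fun φ hφ => by
      have h : (0 : E →L[ℂ] E) ≤ cfc (fun t => φ t) R := cfc_nonneg fun t _ => hφ t
      rw [ContinuousLinearMap.nonneg_iff_isPositive] at h
      simpa using h.re_inner_nonneg_right f)

/-- The spectral measure `μ_f = ⟪f, 1_{(·)}(H) f⟫` of the non-negative self-adjoint operator `H`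
at the vector `f`, as a measure on `ℝ`: the spectral measure of `R = (H + 1)⁻¹` at `f` (from the
Riesz-Markov-Kakutani theorem) is transported by `t ↦ 1 / t - 1`. As `R` is injective, the former
does not charge `0`. -/
def spectralMeasure (H : E →ₗ.[ℂ] E) (f : E) : Measure ℝ :=
  (RealRMK.rieszMeasure (cfcFunctional (resolvent H) f)).map fun t => t⁻¹ - 1

open Classical in
/-- The bounded operator `ψ(H)` of the Borel functional calculus, for bounded measurable `ψ` on
`[0, ∞]`: the unique bounded operator with `⟪f, ψ(H) f⟫ = ∫ ψ dμ_f` for all `f`. (It exists for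
all non-negative self-adjoint `H` by the spectral theorem.) -/
def borelFun (ψ : ℝ≥0∞ → ℂ) (H : E →ₗ.[ℂ] E) : E →L[ℂ] E :=
  if h : ∃ T : E →L[ℂ] E, ∀ f : E,
      ⟪f, T f⟫_ℂ = ∫ t, ψ (ENNReal.ofReal t) ∂(spectralMeasure H f)
  then h.choose else 0

/-- `‖A‖_{m → 0} ≤ c` for an operator `A` on the scale of `H`. -/
def NormLE (H : E →ₗ.[ℂ] E) (m : ℝ) (A : E →L[ℂ] F) (c : ℝ) : Prop :=
  ∀ f : scale H m, ‖A f‖ ≤ c * scaleNorm H m f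

/-- `(H, E)` and `(H', F)` are `δ`-close of order `k` with respect to the quasi-unitary maps
`(J, J₁)` and `(J', J₁')`. -/
structure IsClose (δ k : ℝ) (H : E →ₗ.[ℂ] E) (H' : F →ₗ.[ℂ] F)
    (J : E →L[ℂ] F) (J₁ : scale H 1 →ₗ[ℂ] scale H' 1)
    (J' : F →L[ℂ] E) (J₁' : scale H' 1 →ₗ[ℂ] scale H 1) : Prop where
  scale_left : ∀ f : scale H 1, ‖J f - J₁ f‖ ≤ δ * scaleNorm H 1 f
  scale_right : ∀ u : scale H' 1, ‖J' u - J₁' u‖ ≤ δ * scaleNorm H' 1 u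
  adj : ‖J - ContinuousLinearMap.adjoint J'‖ ≤ δ
  /-- `‖H' J₁ - J₁'^* H‖_{k → -1} ≤ δ`, in terms of the forms. -/
  comm : ∀ (f : scale H 1) (hf : (f : E) ∈ scale H k) (u : scale H' 1),
    ‖form H' (J₁ f) u - form H f (J₁' u)‖ ≤ δ * scaleNorm H k ⟨f, hf⟩ * scaleNorm H' 1 u
  inv_left : NormLE H 1 (ContinuousLinearMap.id ℂ E - J' ∘L J) δ
  inv_right : NormLE H' 1 (ContinuousLinearMap.id ℂ F - J ∘L J') δ
  bdd_left : ‖J‖ ≤ 2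
  bdd_right : ‖J'‖ ≤ 2

/-- The spectrum of `H` is contained in the subset `S` of `[0, ∞)`. -/
def SpecIn (H : E →ₗ.[ℂ] E) (S : Set ℝ≥0) : Prop :=
  spec H ⊆ (fun x : ℝ≥0 => ((x : ℝ) : ℂ)) '' S

end QuasiUnitary

end

open QuasiUnitary

noncomputable section

namespace QuasiUnitary

variable {E : Type*} [NormedAddCommGroup E] [InnerProductSpace ℂ E] [CompleteSpace E]
variable {F : Type*} [NormedAddCommGroup F] [InnerProductSpace ℂ F] [CompleteSpace F]

/-! ### The resolvent at `-1` -/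

namespace IsNonnegSelfAdjoint

variable {H : E →ₗ.[ℂ] E} (hH : IsNonnegSelfAdjoint H)
include hH

/-! Everything is moved to the resolvents `R`, `R'`, bounded with spectrum in `[0, 1]`: `ψ(H)`
becomes `φ(R)` with `φ t = ψ (1/t - 1)` and `φ 0` the limit of `ψ` at infinity. Likewise `S ∪ {∞}`
becomes a compact set `K ∋ 0` at whose points `φ` is continuous, and one of the two spectra lies in
`K`. Closeness of the forms yields `‖(R' J - J R) R^(m/2)‖ ≤ 7δ` (`IsClose.norm_resolvent_sub_le`).
Telescoping powers and Weierstrass approximation extend this to continuous functions, with bound `ε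
+ C δ` (`exists_norm_cfc_intertwine_le`). For general `φ`, extend its restriction to `K` to a
continuous `g`. Then `|g - φ| ≤ ε + χ` on `[0, 1]`, where `χ t = C √t dist(t, K)` is continuous and
vanishes on `K` (`exists_continuous_near_of_continuousAt`). On the side with spectrum in `K`, `g`
and `φ` give the same operator and `χ` gives `0`. The almost intertwining of `χ` carries this
smallness to the other side. If the known spectrum is that of `R'`, this controls only `J χ(R) y`;
the factor `√t` places `χ(R) y` in the form domain, where `J' J` is close to the identity, so `χ(R)
y` itself is small (`exists_norm_borelCalc_intertwine_le`). Since `ε` is arbitrary and `C` does not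
depend on the operators, the infimum of all uniform bounds is the rate (`exists_rate`). -/

theorem inner_symm (x y : H.domain) : ⟪H x, (y : E)⟫_ℂ = ⟪(x : E), H y⟫_ℂ := by
  have h := LinearPMap.adjoint_isFormalAdjoint (T := H) hH.selfAdjoint.dense_domain
  have e : H.adjoint = H := LinearPMap.isSelfAdjoint_def.mp hH.selfAdjoint
  rw [e] at h
  exact h x y

theorem sq_norm_le_re_inner (x : H.domain) :
    ‖(x : E)‖ ^ 2 ≤ (⟪(x : E), H x + (x : E)⟫_ℂ).re := by
  have h := hH.nonneg x
  have h2 : (⟪(x : E), (x : E)⟫_ℂ).re = ‖(x : E)‖ ^ 2 := inner_self_eq_norm_sq (𝕜 := ℂ) (x : E)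
  rw [inner_add_right, Complex.add_re, h2]
  linarith

theorem norm_le_norm_add (x : H.domain) : ‖(x : E)‖ ≤ ‖H x + (x : E)‖ := by
  have h := hH.sq_norm_le_re_inner x
  have h2 : (⟪(x : E), H x + (x : E)⟫_ℂ).re ≤ ‖(x : E)‖ * ‖H x + (x : E)‖ :=
    re_inner_le_norm (𝕜 := ℂ) _ _
  by_contra! hlt
  have h0 : 0 < ‖(x : E)‖ := (norm_nonneg _).trans_lt hlt
  nlinarith

/-- `H + 1` is bounded below, so preimages of a convergent sequence are Cauchy; the closed graph of
`H` then contains the limit. -/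
theorem isClosed_range_add : IsClosed (LinearMap.range (H.toFun + H.domain.subtype) : Set E) := by
  refine IsSeqClosed.isClosed fun y b hy hb => ?_
  choose x hx using hy
  have hx' : ∀ n, H (x n) + (x n : E) = y n := hx
  have hc : CauchySeq fun n => (x n : E) := by
    refine Metric.cauchySeq_iff'.mpr fun ε hε => ?_
    obtain ⟨N, hN⟩ := Metric.cauchySeq_iff'.mp hb.cauchySeq ε hε
    refine ⟨N, fun n hn => lt_of_le_of_lt ?_ (hN n hn)⟩
    rw [dist_eq_norm, dist_eq_norm, ← hx', ← hx']
    have h := hH.norm_le_norm_add (x n - x N)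
    rw [LinearPMap.map_sub, AddSubgroupClass.coe_sub, sub_add_sub_comm] at h
    exact h
  obtain ⟨a, ha⟩ := cauchySeq_tendsto_of_complete hc
  have hHx : Tendsto (fun n => H (x n)) atTop (𝓝 (b - a)) := by
    refine (hb.sub ha).congr fun n => ?_
    rw [← hx']
    abel
  have hg : (a, b - a) ∈ (H.graph : Set (E × E)) :=
    hH.selfAdjoint.isClosed.mem_of_tendsto (ha.prodMk_nhds hHx)
      (Eventually.of_forall fun n => H.mem_graph (x n))
  obtain ⟨z, hz1, hz2⟩ := (LinearPMap.mem_graph_iff H).mp hg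
  refine ⟨z, ?_⟩
  change H z + (z : E) = b
  simp only at hz1 hz2
  rw [hz1, hz2]
  abel

/-- A vector `y` orthogonal to the range lies in the domain of the adjoint, which is `H`, with `H y
= -y`. Non-negativity forces `y = 0`. -/
theorem range_add_eq_top : LinearMap.range (H.toFun + H.domain.subtype) = ⊤ := by
  have hcl := hH.isClosed_range_add
  have : CompleteSpace (LinearMap.range (H.toFun + H.domain.subtype)) :=
    hcl.completeSpace_coe
  rw [← Submodule.orthogonal_eq_bot_iff, Submodule.eq_bot_iff]
  intro y hy
  have hxy : ∀ x : H.domain, ⟪-y, (x : E)⟫_ℂ = ⟪y, H x⟫_ℂ := fun x => by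
    have h : ⟪y, H x + (x : E)⟫_ℂ = 0 :=
      (Submodule.mem_orthogonal' _ y).mp hy _ (LinearMap.mem_range_self _ x)
    rw [inner_add_right] at h
    rw [inner_neg_left]
    linear_combination -h
  have hd := LinearPMap.mem_adjoint_domain_of_exists (T := H) y ⟨-y, hxy⟩
  have ha := LinearPMap.adjoint_apply_eq hH.selfAdjoint.dense_domain ⟨y, hd⟩ hxy
  have e : H.adjoint = H := LinearPMap.isSelfAdjoint_def.mp hH.selfAdjoint
  have key : ∃ z : H.domain, (z : E) = y ∧ H z = -y := by
    rw [← e]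
    exact ⟨⟨y, hd⟩, rfl, ha⟩
  obtain ⟨z, hz1, hz2⟩ := key
  have h := hH.sq_norm_le_re_inner z
  rw [hz2, hz1, neg_add_cancel, inner_zero_right, Complex.zero_re] at h
  exact norm_eq_zero.mp (pow_eq_zero_iff two_ne_zero |>.mp (le_antisymm h (sq_nonneg _)))

theorem exists_isResolventAt : ∃ R : E →L[ℂ] E, IsResolventAt H (-1) R := by
  have hinj : Function.Injective (H.toFun + H.domain.subtype) := by
    rw [injective_iff_map_eq_zero]
    intro x hx
    have h := hH.norm_le_norm_add x
    have hx' : H x + (x : E) = 0 := hx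
    rw [hx', norm_zero] at h
    exact Subtype.ext (norm_le_zero_iff.mp h)
  let e : H.domain ≃ₗ[ℂ] E := LinearEquiv.ofBijective (H.toFun + H.domain.subtype)
    ⟨hinj, LinearMap.range_eq_top.mp hH.range_add_eq_top⟩
  have he : ∀ x, e x = H x + (x : E) := fun x => rfl
  let R : E →L[ℂ] E := (H.domain.subtype ∘ₗ (e.symm : E →ₗ[ℂ] H.domain)).mkContinuous 1 fun f => by
    rw [one_mul]
    have h := hH.norm_le_norm_add (e.symm f)
    rw [← he, LinearEquiv.apply_symm_apply] at h
    exact h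
  have hR : ∀ f, R f = e.symm f := fun f => rfl
  refine ⟨R, fun x => ?_, fun f => ⟨e.symm f, (hR f).symm, ?_⟩⟩
  · rw [neg_one_smul, sub_neg_eq_add, ← he, hR, LinearEquiv.symm_apply_apply]
  · rw [neg_one_smul, sub_neg_eq_add, ← he, LinearEquiv.apply_symm_apply]

theorem isResolventAt_resolvent : IsResolventAt H (-1) (resolvent H) := by
  have h := hH.exists_isResolventAt
  rw [resolvent, dif_pos h]
  exact h.choose_spec

theorem resolvent_apply_add (x : H.domain) : resolvent H (H x + (x : E)) = x := by
  simpa using hH.isResolventAt_resolvent.1 x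

theorem exists_eq_resolvent_apply (f : E) :
    ∃ x : H.domain, (x : E) = resolvent H f ∧ H x + (x : E) = f := by
  simpa using hH.isResolventAt_resolvent.2 f

theorem resolvent_injective : Function.Injective (resolvent H) := by
  rw [injective_iff_map_eq_zero]
  intro f hf
  obtain ⟨x, hx, hx'⟩ := hH.exists_eq_resolvent_apply f
  have : x = 0 := Subtype.ext (hx.trans hf)
  rw [← hx', this]
  simp

theorem norm_resolvent_le : ‖resolvent H‖ ≤ 1 := by
  refine ContinuousLinearMap.opNorm_le_bound _ zero_le_one fun f => ?_
  obtain ⟨x, hx, hx'⟩ := hH.exists_eq_resolvent_apply f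
  rw [← hx, one_mul]
  exact hx' ▸ hH.norm_le_norm_add x

theorem resolvent_nonneg : 0 ≤ resolvent H := by
  rw [ContinuousLinearMap.nonneg_iff_isPositive, ContinuousLinearMap.isPositive_iff]
  have hs : (resolvent H).IsSymmetric := fun f g => by
    obtain ⟨x, hx, hx'⟩ := hH.exists_eq_resolvent_apply f
    obtain ⟨y, hy, hy'⟩ := hH.exists_eq_resolvent_apply g
    change ⟪resolvent H f, g⟫_ℂ = ⟪f, resolvent H g⟫_ℂ
    rw [← hx, ← hy, ← hx', ← hy', inner_add_left, inner_add_right, hH.inner_symm]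
  refine ⟨?_, fun f => ?_⟩
  · exact hs
  · obtain ⟨x, hx, hx'⟩ := hH.exists_eq_resolvent_apply f
    have h := (sq_nonneg _).trans (hH.sq_norm_le_re_inner x)
    rw [hx', hx] at h
    have h2 : (⟪resolvent H f, f⟫_ℂ).im = 0 := by
      rw [← Complex.conj_eq_iff_im, inner_conj_symm]
      exact (hs f f).symm
    rw [Complex.nonneg_iff]
    exact ⟨h, h2.symm⟩

theorem isSelfAdjoint_resolvent : IsSelfAdjoint (resolvent H) :=
  IsSelfAdjoint.of_nonneg hH.resolvent_nonneg

theorem spectrum_resolvent_subset_Icc : spectrum ℝ (resolvent H) ⊆ Icc 0 1 := fun t ht => by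
  refine ⟨spectrum_nonneg_of_nonneg hH.resolvent_nonneg ht, ?_⟩
  have h1 : ‖t‖ ≤ ‖resolvent H‖ * ‖(1 : E →L[ℂ] E)‖ := spectrum.norm_le_norm_mul_of_mem ht
  have h2 : ‖(1 : E →L[ℂ] E)‖ ≤ 1 := ContinuousLinearMap.norm_id_le
  have h3 := hH.norm_resolvent_le
  calc t ≤ ‖t‖ := Real.le_norm_self t
    _ ≤ ‖resolvent H‖ * ‖(1 : E →L[ℂ] E)‖ := h1
    _ ≤ 1 := mul_le_one₀ h3 (norm_nonneg _) h2

/-- Spectral mapping for the resolvent, in the direction that bounds the spectrum of `(H + 1)⁻¹`. -/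
theorem inv_sub_one_mem_spec {t : ℝ} (ht : t ∈ spectrum ℝ (resolvent H)) (h0 : t ≠ 0) :
    ((t⁻¹ - 1 : ℝ) : ℂ) ∈ spec H := by
  rintro ⟨Q, hQ1, hQ2⟩
  refine ht ?_
  set R := resolvent H
  set l : ℂ := ((t⁻¹ - 1 : ℝ) : ℂ) with hl
  have htc : (t : ℂ) ≠ 0 := Complex.ofReal_ne_zero.mpr h0
  have hl' : l = (t : ℂ)⁻¹ - 1 := by simp [hl]
  have hR : ∀ f, algebraMap ℝ (E →L[ℂ] E) t f = (t : ℂ) • f := fun f => by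
    rw [Algebra.algebraMap_eq_smul_one]
    simp
  -- With `l + 1 = 1/t`, formally `(t - R)⁻¹ = t⁻¹ (1 + t⁻¹ (H - l)⁻¹)`.
  let X : E →L[ℂ] E := (t : ℂ)⁻¹ • (1 + (t : ℂ)⁻¹ • Q)
  have hX : ∀ f, X f = (t : ℂ)⁻¹ • (f + (t : ℂ)⁻¹ • Q f) := fun f => rfl
  have h1 : (algebraMap ℝ (E →L[ℂ] E) t - R) * X = 1 := by
    ext f
    obtain ⟨x, hx, hx'⟩ := hQ2 f
    have e : f + (t : ℂ)⁻¹ • (x : E) = H x + (x : E) := by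
      rw [← hx', hl']
      module
    have : X f = (t : ℂ)⁻¹ • (H x + (x : E)) := by rw [hX, ← hx, e]
    simp only [mul_apply_eq_comp, sub_apply, one_apply_eq_self]
    rw [this, hR, map_smul, hH.resolvent_apply_add, smul_smul, mul_inv_cancel₀ htc, one_smul, ← e]
    abel
  have hsa : IsSelfAdjoint (algebraMap ℝ (E →L[ℂ] E) t - R) :=
    (IsSelfAdjoint.algebraMap _ (IsSelfAdjoint.all t)).sub hH.isSelfAdjoint_resolvent
  -- Since `t - R` is self-adjoint, the adjoint of a right inverse is a left inverse.
  have h2 : star X * (algebraMap ℝ (E →L[ℂ] E) t - R) = 1 := by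
    have := congrArg star h1
    rwa [star_mul, hsa.star_eq, star_one] at this
  exact isUnit_iff_exists_and_exists.mpr ⟨⟨X, h1⟩, ⟨star X, h2⟩⟩

end IsNonnegSelfAdjoint

/-! ### The spectral measure of a bounded self-adjoint operator -/

/-- The spectral measure of the bounded self-adjoint operator `R` at the vector `f`. -/
abbrev cfcMeasure (R : E →L[ℂ] E) (f : E) : Measure ℝ :=
  RealRMK.rieszMeasure (cfcFunctional R f)

theorem integral_cfcMeasure_compactlySupported (R : E →L[ℂ] E) (f : E) (φ : C_c(ℝ, ℝ)) :
    ∫ t, φ t ∂(cfcMeasure R f) = (⟪f, (cfc (fun t => φ t) R : E →L[ℂ] E) f⟫_ℂ).re :=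
  RealRMK.integral_rieszMeasure _ φ

theorem isCompact_spectrum (R : E →L[ℂ] E) : IsCompact (spectrum ℝ R) :=
  spectrum.isCompact R

/-- A bump function equal to `1` on a compact set and supported off the spectrum has zero functional
calculus, so that set is null; inner regularity does the rest. -/
theorem cfcMeasure_compl_spectrum (R : E →L[ℂ] E) (f : E) :
    cfcMeasure R f (spectrum ℝ R)ᶜ = 0 := by
  have ho : IsOpen (spectrum ℝ R)ᶜ := (isCompact_spectrum R).isClosed.isOpen_compl
  rw [ho.measure_eq_iSup_isCompact, ENNReal.iSup_eq_zero]
  intro K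
  rw [ENNReal.iSup_eq_zero]
  intro hK
  rw [ENNReal.iSup_eq_zero]
  intro hKc
  obtain ⟨χ, hχ1, hχ2, hχ3, hχ4⟩ := exists_continuousMap_one_of_isCompact_subset_isOpen hKc ho hK
  let φ : C_c(ℝ, ℝ) := ⟨χ, hχ2⟩
  have hφ : ∀ t, φ t = χ t := fun t => rfl
  have hint : ∫ t, φ t ∂(cfcMeasure R f) = 0 := by
    rw [integral_cfcMeasure_compactlySupported]
    have : cfc (fun t => φ t) R = cfc (fun _ : ℝ => (0 : ℝ)) R := cfc_congr fun t ht => by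
      rw [hφ]
      by_contra hne
      exact hχ3 (subset_tsupport _ hne) ht
    rw [this, cfc_const_zero]
    simp
  have hi : Integrable (fun t => φ t) (cfcMeasure R f) :=
    χ.continuous.integrable_of_hasCompactSupport hχ2
  have h0 := (integral_eq_zero_iff_of_nonneg (fun t => (hχ4 t).1) hi).mp hint
  refine measure_mono_null (fun t ht => ?_) (ae_iff.mp h0)
  have h1 : χ t = 1 := hχ1 ht
  simp [h1]

theorem ae_mem_spectrum (R : E →L[ℂ] E) (f : E) : ∀ᵐ t ∂(cfcMeasure R f), t ∈ spectrum ℝ R :=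
  cfcMeasure_compl_spectrum R f

instance isFiniteMeasure_cfcMeasure (R : E →L[ℂ] E) (f : E) :
    IsFiniteMeasure (cfcMeasure R f) := by
  refine ⟨?_⟩
  rw [← union_compl_self (spectrum ℝ R)]
  refine (measure_union_le _ _).trans_lt ?_
  rw [cfcMeasure_compl_spectrum, add_zero]
  exact (isCompact_spectrum R).measure_lt_top

theorem memLp_two_of_continuous (R : E →L[ℂ] E) (f : E) {g : ℝ → ℝ} (hg : Continuous g) :
    MemLp g 2 (cfcMeasure R f) := by
  obtain ⟨C, hC⟩ := (isCompact_spectrum R).exists_bound_of_continuousOn hg.continuousOn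
  exact MemLp.of_bound hg.aestronglyMeasurable C ((ae_mem_spectrum R f).mono hC)

theorem memLp_two_of_bounded (R : E →L[ℂ] E) (f : E) {φ : ℝ → ℝ} (hφ : Measurable φ) {C : ℝ}
    (hC : ∀ t, |φ t| ≤ C) : MemLp φ 2 (cfcMeasure R f) :=
  MemLp.of_bound hφ.aestronglyMeasurable C (Eventually.of_forall hC)

theorem integral_cfcMeasure (R : E →L[ℂ] E) (f : E) {g : ℝ → ℝ} (hg : Continuous g) :
    ∫ t, g t ∂(cfcMeasure R f) = (⟪f, (cfc g R : E →L[ℂ] E) f⟫_ℂ).re := by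
  obtain ⟨χ, hχ1, hχ2, -, -⟩ :=
    exists_continuousMap_one_of_isCompact_subset_isOpen (isCompact_spectrum R) isOpen_univ
      (subset_univ _)
  let φ : C_c(ℝ, ℝ) := ⟨⟨fun t => g t * χ t, hg.mul χ.continuous⟩, HasCompactSupport.mul_left hχ2⟩
  have hφ : ∀ t ∈ spectrum ℝ R, φ t = g t := fun t ht => by
    change g t * χ t = g t
    rw [hχ1 ht, Pi.one_apply, mul_one]
  have h := integral_cfcMeasure_compactlySupported R f φ
  rw [cfc_congr (g := g) hφ] at h
  rw [← h]
  exact integral_congr_ae ((ae_mem_spectrum R f).mono fun t ht => (hφ t ht).symm)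

/-- The isometry behind the Borel calculus: `‖g(R) f‖² = ⟪f, g²(R) f⟫ = ∫ g² dμ_f`. -/
theorem enorm_cfc_apply {R : E →L[ℂ] E} (hR : IsSelfAdjoint R) (f : E) {g : ℝ → ℝ}
    (hg : Continuous g) : ‖(cfc g R : E →L[ℂ] E) f‖ₑ = eLpNorm g 2 (cfcMeasure R f) := by
  have hsa : IsSelfAdjoint (cfc g R : E →L[ℂ] E) := cfc_predicate g R
  have h1 : ∫ t, ‖g t‖ ^ 2 ∂(cfcMeasure R f) = ‖(cfc g R : E →L[ℂ] E) f‖ ^ 2 := by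
    have e : (fun t => ‖g t‖ ^ 2) = fun t => g t * g t := by
      ext t
      rw [Real.norm_eq_abs, sq_abs, sq]
    rw [e, integral_cfcMeasure R f (g := fun t => g t * g t) (hg.mul hg), cfc_mul g g R hg.continuousOn hg.continuousOn,
      mul_apply_eq_comp]
    have h2 := ContinuousLinearMap.adjoint_inner_left (cfc g R : E →L[ℂ] E)
      ((cfc g R : E →L[ℂ] E) f) f
    rw [hsa.adjoint_eq] at h2
    rw [← h2]
    exact inner_self_eq_norm_sq (𝕜 := ℂ) _
  rw [(memLp_two_of_continuous R f hg).eLpNorm_eq_integral_rpow_norm two_ne_zero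
    ENNReal.ofNat_ne_top]
  simp only [ENNReal.toReal_ofNat, Real.rpow_two]
  rw [h1, ← one_div, ← Real.sqrt_eq_rpow, Real.sqrt_sq (norm_nonneg _), ofReal_norm]

/-! ### The Borel functional calculus of a bounded self-adjoint operator -/

theorem exists_continuous_eLpNorm_sub_le (μ : Measure ℝ) [IsFiniteMeasure μ] {φ : ℝ → ℝ}
    (hφ : MemLp φ 2 μ) {ε : ℝ≥0∞} (hε : ε ≠ 0) :
    ∃ g : ℝ → ℝ, Continuous g ∧ eLpNorm (g - φ) 2 μ ≤ ε := by
  obtain ⟨g, hg, -⟩ := hφ.exists_boundedContinuous_eLpNorm_sub_le ENNReal.ofNat_ne_top hε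
  exact ⟨g, g.continuous, by rwa [eLpNorm_sub_comm]⟩

theorem enorm_cfc_sub_cfc {R : E →L[ℂ] E} (hR : IsSelfAdjoint R) (f : E) {g h : ℝ → ℝ}
    (hg : Continuous g) (hh : Continuous h) :
    ‖(cfc g R : E →L[ℂ] E) f - (cfc h R : E →L[ℂ] E) f‖ₑ = eLpNorm (g - h) 2 (cfcMeasure R f) := by
  rw [← enorm_cfc_apply hR f (hg.sub hh)]
  rw [show (g - h) = fun t => g t - h t from rfl, cfc_sub g h R hg.continuousOn hh.continuousOn]
  rfl

/-- Continuous functions are dense in `L²(μ_f)`, so the isometry `g ↦ g(R) f` extends to `φ`; `v`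
plays the role of `φ(R) f`. -/
theorem exists_vector_of_bounded {R : E →L[ℂ] E} (hR : IsSelfAdjoint R) (f : E) {φ : ℝ → ℝ}
    (hφ : MemLp φ 2 (cfcMeasure R f)) :
    ∃ v : E, ∀ g : ℝ → ℝ, Continuous g →
      ‖(cfc g R : E →L[ℂ] E) f - v‖ₑ = eLpNorm (g - φ) 2 (cfcMeasure R f) := by
  set μ := cfcMeasure R f
  have hex : ∀ n : ℕ, ∃ g : ℝ → ℝ, Continuous g ∧ eLpNorm (g - φ) 2 μ ≤ ((n : ℝ≥0∞) + 1)⁻¹ :=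
    fun n => exists_continuous_eLpNorm_sub_le μ hφ (by simp)
  choose g hg hgφ using hex
  have hlim : Tendsto (fun n => eLpNorm (g n - φ) 2 μ) atTop (𝓝 0) := by
    refine tendsto_of_tendsto_of_tendsto_of_le_of_le tendsto_const_nhds ?_ (fun _ => zero_le) hgφ
    have := (ENNReal.tendsto_inv_nat_nhds_zero).comp (tendsto_add_atTop_nat 1)
    refine this.congr fun n => by simp
  have tri : ∀ {a b c : ℝ → ℝ}, MemLp a 2 μ → MemLp b 2 μ → MemLp c 2 μ →
      eLpNorm (a - c) 2 μ ≤ eLpNorm (a - b) 2 μ + eLpNorm (b - c) 2 μ := fun {a b c} ha hb hc => by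
    rw [← sub_add_sub_cancel a b c]
    exact eLpNorm_add_le (ha.sub hb).1 (hb.sub hc).1 one_le_two
  have hgm : ∀ n, MemLp (g n) 2 μ := fun n => memLp_two_of_continuous R f (hg n)
  have hc : CauchySeq fun n => (cfc (g n) R : E →L[ℂ] E) f := by
    refine EMetric.cauchySeq_iff.mpr fun ε hε => ?_
    have hε2 : 0 < ε / 2 := ENNReal.half_pos hε.ne'
    obtain ⟨N, hN⟩ := eventually_atTop.mp (hlim.eventually (gt_mem_nhds hε2))
    refine ⟨N, fun m hm n hn => ?_⟩
    rw [edist_eq_enorm_sub, enorm_cfc_sub_cfc hR f (hg m) (hg n)]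
    calc _ ≤ eLpNorm (g m - φ) 2 μ + eLpNorm (φ - g n) 2 μ := tri (hgm m) hφ (hgm n)
      _ < ε / 2 + ε / 2 := by
        rw [eLpNorm_sub_comm φ]
        exact ENNReal.add_lt_add (hN m hm) (hN n hn)
      _ = ε := ENNReal.add_halves ε
  obtain ⟨v, hv⟩ := cauchySeq_tendsto_of_complete hc
  refine ⟨v, fun h hh => ?_⟩
  have h1 : Tendsto (fun n => ‖(cfc h R : E →L[ℂ] E) f - (cfc (g n) R : E →L[ℂ] E) f‖ₑ) atTop
      (𝓝 ‖(cfc h R : E →L[ℂ] E) f - v‖ₑ) := (tendsto_const_nhds.sub hv).enorm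
  simp_rw [fun n => enorm_cfc_sub_cfc hR f hh (hg n)] at h1
  have hhm := memLp_two_of_continuous R f hh
  refine le_antisymm ?_ ?_
  · refine le_of_tendsto_of_tendsto' h1 (g := fun n => eLpNorm (h - φ) 2 μ + eLpNorm (g n - φ) 2 μ)
      ?_ fun n => ?_
    · simpa using tendsto_const_nhds.add hlim
    · rw [eLpNorm_sub_comm (g n)]
      exact tri hhm hφ (hgm n)
  · refine le_of_tendsto_of_tendsto' (b := atTop) tendsto_const_nhds
      (g := fun n => eLpNorm (h - g n) 2 μ + eLpNorm (g n - φ) 2 μ) ?_ fun n =>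
      tri hhm (hgm n) hφ
    simpa using h1.add hlim

/-- A bounded operator `T` that deserves the name `φ(R)`. -/
def IsBorelCalc (R : E →L[ℂ] E) (φ : ℝ → ℝ) (T : E →L[ℂ] E) : Prop :=
  ∀ f : E, ∀ g : ℝ → ℝ, Continuous g →
    ‖(cfc g R : E →L[ℂ] E) f - T f‖ₑ = eLpNorm (g - φ) 2 (cfcMeasure R f)

/-- Approximation in `L²` of the sum of the three spectral measures makes one `g` serve all three
vectors. This is what linearity of `f ↦ v f` needs. -/
theorem exists_continuous_enorm_sub_le {R : E →L[ℂ] E} {φ : ℝ → ℝ}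
    (hφ : Measurable φ) {C : ℝ} (hC : ∀ t, |φ t| ≤ C) {v : E → E}
    (hv : ∀ f : E, ∀ g : ℝ → ℝ, Continuous g →
      ‖(cfc g R : E →L[ℂ] E) f - v f‖ₑ = eLpNorm (g - φ) 2 (cfcMeasure R f))
    (f₁ f₂ f₃ : E) {ε : ℝ} (hε : 0 < ε) :
    ∃ g : ℝ → ℝ, Continuous g ∧ ‖(cfc g R : E →L[ℂ] E) f₁ - v f₁‖ ≤ ε ∧
      ‖(cfc g R : E →L[ℂ] E) f₂ - v f₂‖ ≤ ε ∧ ‖(cfc g R : E →L[ℂ] E) f₃ - v f₃‖ ≤ ε := by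
  obtain ⟨g, hg, hgφ⟩ := exists_continuous_eLpNorm_sub_le
    (cfcMeasure R f₁ + cfcMeasure R f₂ + cfcMeasure R f₃)
    (MemLp.of_bound hφ.aestronglyMeasurable C (Eventually.of_forall hC) : MemLp φ 2 _)
    (ENNReal.ofReal_pos.mpr hε).ne'
  have key : ∀ f, cfcMeasure R f ≤ cfcMeasure R f₁ + cfcMeasure R f₂ + cfcMeasure R f₃ →
      ‖(cfc g R : E →L[ℂ] E) f - v f‖ ≤ ε := fun f hf => by
    rw [← ENNReal.ofReal_le_ofReal_iff hε.le, ofReal_norm, hv f g hg]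
    exact (eLpNorm_mono_measure _ hf).trans hgφ
  refine ⟨g, hg, key _ ?_, key _ ?_, key _ ?_⟩
  · rw [add_assoc]; exact Measure.le_add_right le_rfl
  · rw [add_comm (cfcMeasure R f₁), add_assoc]; exact Measure.le_add_right le_rfl
  · exact Measure.le_add_left le_rfl

theorem exists_isBorelCalc {R : E →L[ℂ] E} (hR : IsSelfAdjoint R) {φ : ℝ → ℝ}
    (hφ : Measurable φ) {C : ℝ} (hC : ∀ t, |φ t| ≤ C) : ∃ T : E →L[ℂ] E, IsBorelCalc R φ T := by
  choose v hv using fun f => exists_vector_of_bounded hR f (memLp_two_of_bounded R f hφ hC)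
  have hadd : ∀ f h, v (f + h) = v f + v h := fun f h => by
    refine eq_of_norm_sub_le_zero (le_of_forall_pos_le_add fun ε hε => ?_)
    obtain ⟨g, -, h1, h2, h3⟩ := exists_continuous_enorm_sub_le hφ hC hv f h (f + h)
      (ε := ε / 3) (by positivity)
    have e : v (f + h) - (v f + v h) = ((cfc g R : E →L[ℂ] E) f - v f) +
        ((cfc g R : E →L[ℂ] E) h - v h) - ((cfc g R : E →L[ℂ] E) (f + h) - v (f + h)) := by
      rw [map_add]
      abel
    rw [e]
    refine (norm_sub_le _ _).trans ?_
    have := norm_add_le ((cfc g R : E →L[ℂ] E) f - v f) ((cfc g R : E →L[ℂ] E) h - v h)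
    linarith
  have hsmul : ∀ (c : ℂ) f, v (c • f) = c • v f := fun c f => by
    refine eq_of_norm_sub_le_zero (le_of_forall_pos_le_add fun ε hε => ?_)
    have hc : 0 < ‖c‖ + 1 := by positivity
    obtain ⟨g, -, h1, h2, -⟩ := exists_continuous_enorm_sub_le hφ hC hv f (c • f) f
      (ε := ε / (‖c‖ + 1)) (by positivity)
    have e : v (c • f) - c • v f = c • ((cfc g R : E →L[ℂ] E) f - v f) -
        ((cfc g R : E →L[ℂ] E) (c • f) - v (c • f)) := by
      rw [map_smul, smul_sub]
      abel
    rw [e, zero_add]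
    refine (norm_sub_le _ _).trans ?_
    rw [norm_smul]
    calc _ ≤ ‖c‖ * (ε / (‖c‖ + 1)) + ε / (‖c‖ + 1) := by gcongr
      _ = ε := by field_simp
  have hC0 : 0 ≤ C := (abs_nonneg _).trans (hC 0)
  -- Taking `g = 0` gives `‖v f‖` as the `L²` norm of `φ`, which is at most that of the constant
  -- `C`, namely `C ‖f‖`.
  have hbd : ∀ f, ‖v f‖ ≤ C * ‖f‖ := fun f => by
    have h0 := hv f (fun _ => 0) continuous_const
    rw [cfc_const_zero, zero_apply, zero_sub, enorm_neg] at h0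
    have h1 : eLpNorm ((fun _ => (0 : ℝ)) - φ) 2 (cfcMeasure R f) ≤
        eLpNorm (fun _ : ℝ => C) 2 (cfcMeasure R f) := eLpNorm_mono fun t => by
      simpa [abs_of_nonneg hC0] using hC t
    rw [← h0, ← enorm_cfc_apply hR f continuous_const, cfc_const C R,
      Algebra.algebraMap_eq_smul_one, smul_apply, one_apply_eq_self, ← ofReal_norm,
      ← ofReal_norm, ENNReal.ofReal_le_ofReal_iff (norm_nonneg _), norm_smul, Real.norm_eq_abs,
      abs_of_nonneg hC0] at h1
    exact h1
  exact ⟨LinearMap.mkContinuous ⟨⟨v, hadd⟩, hsmul⟩ C hbd, hv⟩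

theorem IsBorelCalc.inner_eq_integral {R : E →L[ℂ] E} (hR : IsSelfAdjoint R) {φ : ℝ → ℝ}
    {T : E →L[ℂ] E} (hT : IsBorelCalc R φ T) (f : E) (hφ : MemLp φ 2 (cfcMeasure R f)) :
    ⟪f, T f⟫_ℂ = ((∫ t, φ t ∂(cfcMeasure R f) : ℝ) : ℂ) := by
  set μ := cfcMeasure R f
  -- The Cauchy–Schwarz factor in passing from `L²` to `L¹`.
  set M : ℝ := (μ univ ^ (1 / 2 : ℝ)).toReal with hM
  have hMtop : μ univ ^ (1 / 2 : ℝ) ≠ ∞ :=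
    ENNReal.rpow_ne_top_of_nonneg (by norm_num) (measure_ne_top μ univ)
  have key : ∀ ε : ℝ, 0 < ε →
      ‖⟪f, T f⟫_ℂ - ((∫ t, φ t ∂μ : ℝ) : ℂ)‖ ≤ ε * (‖f‖ + M) := fun ε hε => by
    obtain ⟨g, hg, hgφ⟩ := exists_continuous_eLpNorm_sub_le μ hφ (ENNReal.ofReal_pos.mpr hε).ne'
    have hgm := memLp_two_of_continuous R f hg
    have h1 : ‖(cfc g R : E →L[ℂ] E) f - T f‖ ≤ ε := by
      rw [← ENNReal.ofReal_le_ofReal_iff hε.le, ofReal_norm, hT f g hg]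
      exact hgφ
    have h2 : ‖∫ t, g t ∂μ - ∫ t, φ t ∂μ‖ ≤ ε * M := by
      rw [← integral_sub (hgm.integrable one_le_two) (hφ.integrable one_le_two),
        ← ENNReal.ofReal_le_ofReal_iff (by positivity), ofReal_norm, ENNReal.ofReal_mul hε.le, hM,
        ENNReal.ofReal_toReal hMtop]
      refine (enorm_integral_le_lintegral_enorm _).trans ?_
      have h3 := eLpNorm_le_eLpNorm_mul_rpow_measure_univ (μ := μ) (p := 1) (q := 2) one_le_two
        (hgm.sub hφ).1
      rw [eLpNorm_one_eq_lintegral_enorm] at h3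
      refine h3.trans ?_
      have e : 1 / (1 : ℝ≥0∞).toReal - 1 / (2 : ℝ≥0∞).toReal = 1 / 2 := by norm_num
      rw [e]
      gcongr
    have hsa : IsSelfAdjoint (cfc g R : E →L[ℂ] E) := cfc_predicate g R
    have h4 : ⟪f, (cfc g R : E →L[ℂ] E) f⟫_ℂ = ((∫ t, g t ∂μ : ℝ) : ℂ) := by
      rw [integral_cfcMeasure R f hg]
      have h5 : (starRingEnd ℂ) ⟪f, (cfc g R : E →L[ℂ] E) f⟫_ℂ = ⟪f, (cfc g R : E →L[ℂ] E) f⟫_ℂ := by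
        rw [inner_conj_symm]
        exact hsa.isSymmetric f f
      exact (Complex.conj_eq_iff_re.mp h5).symm
    have e : ⟪f, T f⟫_ℂ - ((∫ t, φ t ∂μ : ℝ) : ℂ) = -⟪f, (cfc g R : E →L[ℂ] E) f - T f⟫_ℂ +
        ((∫ t, g t ∂μ - ∫ t, φ t ∂μ : ℝ) : ℂ) := by
      rw [inner_sub_right, h4]
      push_cast
      ring
    rw [e]
    refine (norm_add_le _ _).trans ?_
    rw [norm_neg, Complex.norm_real, mul_add]
    refine add_le_add ((norm_inner_le_norm _ _).trans ?_) h2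
    rw [mul_comm]
    gcongr
  refine eq_of_norm_sub_le_zero (le_of_forall_pos_le_add fun ε hε => ?_)
  have hp : 0 < ‖f‖ + M + 1 := by positivity
  refine (key (ε / (‖f‖ + M + 1)) (by positivity)).trans ?_
  rw [zero_add, div_mul_eq_mul_div, div_le_iff₀ hp]
  exact mul_le_mul_of_nonneg_left (by linarith) hε.le

/-- Let `T` be the indicator of `{0}` applied to `R`. As `t` times that indicator vanishes, `R T f =
0`; injectivity gives `T f = 0`, so the indicator is null in `L²(μ_f)`. -/
theorem cfcMeasure_singleton_zero {R : E →L[ℂ] E} (hR : IsSelfAdjoint R)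
    (hs : spectrum ℝ R ⊆ Icc 0 1) (hinj : Function.Injective R) (f : E) :
    cfcMeasure R f {0} = 0 := by
  set μ := cfcMeasure R f
  have hm : Measurable (indicator {(0 : ℝ)} (1 : ℝ → ℝ)) :=
    measurable_one.indicator (measurableSet_singleton 0)
  have hb : ∀ t : ℝ, |indicator {(0 : ℝ)} (1 : ℝ → ℝ) t| ≤ 1 := fun t => by
    by_cases h : t = 0 <;> simp [h]
  obtain ⟨T, hT⟩ := exists_isBorelCalc hR hm hb
  have hRT : R (T f) = 0 := by
    rw [← norm_le_zero_iff]
    refine le_of_forall_pos_le_add fun ε hε => ?_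
    have hp : 0 < ‖R‖ + 1 := by positivity
    obtain ⟨g, hg, hgφ⟩ := exists_continuous_eLpNorm_sub_le μ (memLp_two_of_bounded R f hm hb)
      (ε := ENNReal.ofReal (ε / (‖R‖ + 1))) (ENNReal.ofReal_pos.mpr (by positivity)).ne'
    have h1 : ‖(cfc g R : E →L[ℂ] E) f - T f‖ ≤ ε / (‖R‖ + 1) := by
      rw [← ENNReal.ofReal_le_ofReal_iff (by positivity), ofReal_norm, hT f g hg]
      exact hgφ
    have h2 : ‖R ((cfc g R : E →L[ℂ] E) f)‖ ≤ ε / (‖R‖ + 1) := by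
      have e : R ((cfc g R : E →L[ℂ] E) f) = (cfc (fun t => id t * g t) R : E →L[ℂ] E) f := by
        rw [cfc_mul id g R continuousOn_id hg.continuousOn, cfc_id ℝ R]
        rfl
      rw [← ENNReal.ofReal_le_ofReal_iff (by positivity), ofReal_norm, e,
        enorm_cfc_apply hR f (g := fun t => id t * g t) (continuous_id.mul hg)]
      -- On `[0, 1]`, `|t g t|` is at most the distance of `g t` to the indicator of `{0}`: both
      -- sides are compared separately at `t = 0` and `t > 0`.
      refine (eLpNorm_mono_ae ?_).trans hgφ
      filter_upwards [ae_mem_spectrum R f] with t ht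
      by_cases h : t = 0
      · simp [h]
      · obtain ⟨h0, h1⟩ := hs ht
        simp only [id, norm_mul, Real.norm_eq_abs, Pi.sub_apply, indicator, mem_singleton_iff, h,
          if_false, sub_zero, abs_of_nonneg h0]
        exact mul_le_of_le_one_left (abs_nonneg _) h1
    have e : R (T f) = R ((cfc g R : E →L[ℂ] E) f) - R ((cfc g R : E →L[ℂ] E) f - T f) := by
      rw [map_sub]
      abel
    rw [e, zero_add]
    refine (norm_sub_le _ _).trans ?_
    calc _ ≤ ε / (‖R‖ + 1) + ‖R‖ * (ε / (‖R‖ + 1)) := by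
          refine add_le_add h2 ((R.le_opNorm _).trans ?_)
          gcongr
      _ = ε := by field_simp; ring
  have hTf : T f = 0 := hinj (by rw [hRT, map_zero])
  have h0 := hT f (fun _ => 0) continuous_const
  rw [cfc_const_zero, hTf, zero_apply, sub_zero, enorm_zero] at h0
  have h1 := (eLpNorm_eq_zero_iff (measurable_const.sub hm).aestronglyMeasurable
    two_ne_zero).mp h0.symm
  refine measure_mono_null (fun t ht => ?_) (ae_iff.mp h1)
  rw [mem_singleton_iff] at ht
  simp [ht]

/-- The bounded operator `ψ(H)` in terms of the functional calculus of the resolvent. -/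
theorem IsNonnegSelfAdjoint.borelFun_eq {H : E →ₗ.[ℂ] E} (hH : IsNonnegSelfAdjoint H)
    {ψ : ℝ≥0∞ → ℂ} (hψ : Measurable ψ) {φ₁ φ₂ : ℝ → ℝ}
    (hm₁ : Measurable φ₁) (hm₂ : Measurable φ₂) {C : ℝ} (hC₁ : ∀ t, |φ₁ t| ≤ C)
    (hC₂ : ∀ t, |φ₂ t| ≤ C) (hφ₁ : ∀ t : ℝ, 0 < t → φ₁ t = (ψ (ENNReal.ofReal (t⁻¹ - 1))).re)
    (hφ₂ : ∀ t : ℝ, 0 < t → φ₂ t = (ψ (ENNReal.ofReal (t⁻¹ - 1))).im) {T₁ T₂ : E →L[ℂ] E}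
    (hT₁ : IsBorelCalc (resolvent H) φ₁ T₁) (hT₂ : IsBorelCalc (resolvent H) φ₂ T₂) :
    borelFun ψ H = T₁ + Complex.I • T₂ := by
  have hR := hH.isSelfAdjoint_resolvent
  have hT : ∀ f : E, ⟪f, (T₁ + Complex.I • T₂) f⟫_ℂ =
      ∫ t, ψ (ENNReal.ofReal t) ∂(spectralMeasure H f) := fun f => by
    have hi : ∀ {φ : ℝ → ℝ}, Measurable φ → (∀ t, |φ t| ≤ C) →
        Integrable φ (cfcMeasure (resolvent H) f) := fun h1 h2 =>
      (memLp_two_of_bounded _ f h1 h2).integrable one_le_two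
    have hmt : Measurable fun t : ℝ => t⁻¹ - 1 := measurable_inv.sub_const 1
    rw [spectralMeasure, integral_map (f := fun t => ψ (ENNReal.ofReal t)) hmt.aemeasurable
      (hψ.comp ENNReal.measurable_ofReal).aestronglyMeasurable]
    have hae : ∀ᵐ t ∂(cfcMeasure (resolvent H) f),
        ψ (ENNReal.ofReal (t⁻¹ - 1)) = (φ₁ t : ℂ) + Complex.I * (φ₂ t : ℂ) := by
      have h0 : ∀ᵐ t ∂(cfcMeasure (resolvent H) f), t ≠ 0 := by
        rw [ae_iff]
        simpa using cfcMeasure_singleton_zero hR hH.spectrum_resolvent_subset_Icc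
          hH.resolvent_injective f
      filter_upwards [h0, ae_mem_spectrum (resolvent H) f] with t ht0 hts
      have ht : 0 < t := lt_of_le_of_ne (hH.spectrum_resolvent_subset_Icc hts).1 ht0.symm
      rw [hφ₁ t ht, hφ₂ t ht, mul_comm, Complex.re_add_im]
    rw [integral_congr_ae hae, integral_add (hi hm₁ hC₁).ofReal ((hi hm₂ hC₂).ofReal.const_mul _),
      integral_const_mul, integral_complex_ofReal, integral_complex_ofReal, add_apply, smul_apply,
      inner_add_right, inner_smul_right,
      hT₁.inner_eq_integral hR f (memLp_two_of_bounded _ f hm₁ hC₁),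
      hT₂.inner_eq_integral hR f (memLp_two_of_bounded _ f hm₂ hC₂)]
  have hex : ∃ T : E →L[ℂ] E, ∀ f : E,
      ⟪f, T f⟫_ℂ = ∫ t, ψ (ENNReal.ofReal t) ∂(spectralMeasure H f) := ⟨_, hT⟩
  rw [borelFun, dif_pos hex]
  have h := hex.choose_spec
  have h2 : ∀ f : E, ⟪f, hex.choose f⟫_ℂ = ⟪f, (T₁ + Complex.I • T₂) f⟫_ℂ := fun f =>
    (h f).trans (hT f).symm
  -- By complex polarization, the quadratic form determines the operator, so the chosen one is the
  -- one constructed.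
  refine ContinuousLinearMap.coe_injective ((ext_inner_map _ _).mp fun f => ?_)
  have h3 := congrArg (starRingEnd ℂ) (h2 f)
  rwa [inner_conj_symm, inner_conj_symm] at h3

/-! ### Powers of the resolvent and the scale of Hilbert spaces -/

theorem rpow_add_of_nonneg (R : E →L[ℂ] E) {x y : ℝ} (hx : 0 ≤ x) (hy : 0 ≤ y)
    (hR : 0 ≤ R) : R ^ (x + y) = R ^ x * R ^ y := by
  rw [CFC.rpow_def, CFC.rpow_def, CFC.rpow_def,
    ← cfc_mul _ _ R (NNReal.continuous_rpow_const hx).continuousOn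
      (NNReal.continuous_rpow_const hy).continuousOn]
  exact cfc_congr fun t _ => NNReal.rpow_add_of_nonneg t hx hy

theorem inner_rpow_left (R : E →L[ℂ] E) (x : ℝ) (f g : E) :
    ⟪(R ^ x : E →L[ℂ] E) f, g⟫_ℂ = ⟪f, (R ^ x : E →L[ℂ] E) g⟫_ℂ :=
  (IsSelfAdjoint.of_nonneg (CFC.rpow_nonneg : 0 ≤ (R ^ x : E →L[ℂ] E))).isSymmetric f g

namespace IsNonnegSelfAdjoint

variable {H : E →ₗ.[ℂ] E} (hH : IsNonnegSelfAdjoint H)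
include hH

/-- For an integer `n ≥ x`, `R^(n - x) R^x = R^n` is injective. -/
theorem rpow_injective {x : ℝ} (hx : 0 ≤ x) :
    Function.Injective (resolvent H ^ x : E →L[ℂ] E) := by
  obtain ⟨n, hn⟩ := exists_nat_ge x
  have h1 : (resolvent H ^ ((n : ℝ) - x) : E →L[ℂ] E) * resolvent H ^ x = resolvent H ^ n := by
    rw [← rpow_add_of_nonneg _ (sub_nonneg.mpr hn) hx hH.resolvent_nonneg, sub_add_cancel,
      CFC.rpow_natCast _ _ hH.resolvent_nonneg]
  have h2 : ∀ n : ℕ, Function.Injective (resolvent H ^ n : E →L[ℂ] E) := fun n => by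
    induction n with
    | zero => exact fun a b h => h
    | succ n ih =>
      rw [pow_succ]
      exact ih.comp hH.resolvent_injective
  have h3 := h2 n
  rw [← h1] at h3
  exact Function.Injective.of_comp (f := (resolvent H ^ ((n : ℝ) - x) : E →L[ℂ] E)) h3

theorem norm_rpow_le_one {x : ℝ} (hx : 0 ≤ x) : ‖(resolvent H ^ x : E →L[ℂ] E)‖ ≤ 1 := by
  rw [CFC.rpow_eq_cfc_real (hH.resolvent_nonneg)]
  refine norm_cfc_le zero_le_one fun t ht => ?_
  obtain ⟨h0, h1⟩ := hH.spectrum_resolvent_subset_Icc ht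
  rw [Real.norm_of_nonneg (Real.rpow_nonneg h0 x)]
  exact Real.rpow_le_one h0 h1 hx

theorem norm_rpow_apply_le {x : ℝ} (hx : 0 ≤ x) (f : E) :
    ‖(resolvent H ^ x : E →L[ℂ] E) f‖ ≤ ‖f‖ := by
  simpa using (resolvent H ^ x : E →L[ℂ] E).le_of_opNorm_le (hH.norm_rpow_le_one hx) f

theorem commute_cfc_rpow (g : ℝ → ℝ) (x : ℝ) :
    Commute (cfc g (resolvent H)) (resolvent H ^ x : E →L[ℂ] E) := by
  rw [CFC.rpow_eq_cfc_real (hH.resolvent_nonneg)]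
  exact cfc_commute_cfc _ _ _

theorem rpow_half_mul_self : (resolvent H ^ (1 / 2 : ℝ) : E →L[ℂ] E) * resolvent H ^ (1 / 2 : ℝ) =
    resolvent H := by
  rw [← rpow_add_of_nonneg _ (by norm_num) (by norm_num) hH.resolvent_nonneg, add_halves,
    CFC.rpow_one _ hH.resolvent_nonneg]

theorem rpow_half_apply (f : E) : (resolvent H ^ (1 / 2 : ℝ) : E →L[ℂ] E)
    ((resolvent H ^ (1 / 2 : ℝ) : E →L[ℂ] E) f) = resolvent H f := by
  conv_rhs => rw [← hH.rpow_half_mul_self]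
  rfl

end IsNonnegSelfAdjoint

theorem mem_scale_iff {H : E →ₗ.[ℂ] E} {k : ℝ} {f : E} :
    f ∈ scale H k ↔ ∃ g, (resolvent H ^ (k / 2) : E →L[ℂ] E) g = f := by
  rw [scale, shiftPow, LinearPMap.inverse_domain]
  constructor
  · rintro ⟨g, hg⟩
    exact ⟨g, hg⟩
  · rintro ⟨g, hg⟩
    exact ⟨⟨g, trivial⟩, hg⟩

theorem IsNonnegSelfAdjoint.shiftPow_apply {H : E →ₗ.[ℂ] E} (hH : IsNonnegSelfAdjoint H) {k : ℝ}
    (hk : 0 ≤ k) (f : scale H k) {g : E} (hg : (resolvent H ^ (k / 2) : E →L[ℂ] E) g = f) :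
    shiftPow H k f = g := by
  have hker : LinearMap.ker (LinearMap.toPMap
      ((resolvent H ^ (k / 2) : E →L[ℂ] E) : E →ₗ[ℂ] E) ⊤).toFun = ⊥ := by
    rw [LinearMap.ker_eq_bot]
    intro a b hab
    exact Subtype.ext (hH.rpow_injective (div_nonneg hk zero_le_two) hab)
  exact LinearPMap.inverse_apply_eq hker (x := ⟨g, trivial⟩) hg

theorem IsNonnegSelfAdjoint.scaleNorm_eq {H : E →ₗ.[ℂ] E} (hH : IsNonnegSelfAdjoint H) {k : ℝ}
    (hk : 0 ≤ k) (f : scale H k) {g : E} (hg : (resolvent H ^ (k / 2) : E →L[ℂ] E) g = f) :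
    scaleNorm H k f = ‖g‖ := by
  rw [scaleNorm, hH.shiftPow_apply hk f hg]

/-- The scale of order `m` is the isometric image of `E` under `R^(m/2)`, so the bound becomes one
for the everywhere defined operator `A R^(m/2)`. -/
theorem IsNonnegSelfAdjoint.normLE_iff {H : E →ₗ.[ℂ] E} (hH : IsNonnegSelfAdjoint H) {m : ℝ}
    (hm : 0 ≤ m) (A : E →L[ℂ] F) (c : ℝ) :
    NormLE H m A c ↔ ∀ g, ‖A ((resolvent H ^ (m / 2) : E →L[ℂ] E) g)‖ ≤ c * ‖g‖ := by
  constructor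
  · intro h g
    have := h ⟨_, mem_scale_iff.mpr ⟨g, rfl⟩⟩
    rwa [hH.scaleNorm_eq hm _ rfl] at this
  · intro h f
    obtain ⟨g, hg⟩ := mem_scale_iff.mp f.2
    rw [hH.scaleNorm_eq hm f hg, ← hg]
    exact h g

theorem IsNonnegSelfAdjoint.form_apply {H : E →ₗ.[ℂ] E} (hH : IsNonnegSelfAdjoint H)
    (f g : scale H 1) {a b : E} (ha : (resolvent H ^ (1 / 2 : ℝ) : E →L[ℂ] E) a = f)
    (hb : (resolvent H ^ (1 / 2 : ℝ) : E →L[ℂ] E) b = g) :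
    form H f g = ⟪a, b⟫_ℂ - ⟪(f : E), (g : E)⟫_ℂ := by
  rw [form, hH.shiftPow_apply zero_le_one f ha, hH.shiftPow_apply zero_le_one g hb]

theorem IsNonnegSelfAdjoint.resolvent_mem_scale_one {H : E →ₗ.[ℂ] E} (hH : IsNonnegSelfAdjoint H)
    (f : E) : resolvent H f ∈ scale H 1 :=
  mem_scale_iff.mpr ⟨_, hH.rpow_half_apply f⟩

/-- The closeness of the forms implies closeness of the resolvents. -/
theorem IsClose.norm_resolvent_sub_le {δ k : ℝ} {H : E →ₗ.[ℂ] E} {H' : F →ₗ.[ℂ] F}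
    {J : E →L[ℂ] F} {J₁ : scale H 1 →ₗ[ℂ] scale H' 1} {J' : F →L[ℂ] E}
    {J₁' : scale H' 1 →ₗ[ℂ] scale H 1} (h : IsClose δ k H H' J J₁ J' J₁') (hδ : 0 < δ)
    (hk : 1 ≤ k) (hH : IsNonnegSelfAdjoint H) (hH' : IsNonnegSelfAdjoint H') (x : E) :
    ‖(resolvent H' ∘L J - J ∘L resolvent H)
      ((resolvent H ^ (max 0 (k - 2) / 2) : E →L[ℂ] E) x)‖ ≤ 7 * δ * ‖x‖ := by
  set m := max 0 (k - 2) with hm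
  have hm0 : 0 ≤ m := le_max_left _ _
  have hm1 : k - 2 ≤ m := le_max_right _ _
  set p := (resolvent H ^ (m / 2) : E →L[ℂ] E) x with hp
  have hpx : ‖p‖ ≤ ‖x‖ := hH.norm_rpow_apply_le (by positivity) x
  have hhalf : (0 : ℝ) ≤ 1 / 2 := by norm_num
  -- the vector whose image under the power of order `k` is `R p`
  obtain ⟨y, hy, hyx⟩ : ∃ y, (resolvent H ^ (k / 2) : E →L[ℂ] E) y = resolvent H p ∧
      ‖y‖ ≤ ‖x‖ := by
    -- The exponent is non-negative exactly because `m ≥ k - 2`; this is where the value of `m`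
    -- enters.
    refine ⟨(resolvent H ^ (m / 2 + 1 - k / 2) : E →L[ℂ] E) x, ?_,
      hH.norm_rpow_apply_le (by linarith) x⟩
    have e : (resolvent H ^ (k / 2) : E →L[ℂ] E) * resolvent H ^ (m / 2 + 1 - k / 2) =
        resolvent H * resolvent H ^ (m / 2) := by
      rw [← rpow_add_of_nonneg _ (by linarith) (by linarith) hH.resolvent_nonneg,
        add_sub_cancel, add_comm (m / 2), rpow_add_of_nonneg _ zero_le_one (by positivity)
        hH.resolvent_nonneg, CFC.rpow_one _ hH.resolvent_nonneg]
    exact congrArg (fun A : E →L[ℂ] E => A x) e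
  suffices hw : ∀ u : F, ‖⟪J (resolvent H p) - resolvent H' (J p), u⟫_ℂ‖ ≤ 7 * δ * ‖x‖ * ‖u‖ by
    have h1 := hw (J (resolvent H p) - resolvent H' (J p))
    rw [inner_self_eq_norm_sq_to_K, norm_pow, RCLike.norm_ofReal, abs_norm] at h1
    have e : (resolvent H' ∘L J - J ∘L resolvent H) p =
        -(J (resolvent H p) - resolvent H' (J p)) := by
      simp
    rw [e, norm_neg]
    by_contra! hlt
    have h0 : 0 < ‖J (resolvent H p) - resolvent H' (J p)‖ :=
      lt_of_le_of_lt (by positivity) hlt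
    nlinarith
  intro u
  let f' : scale H 1 := ⟨resolvent H p, hH.resolvent_mem_scale_one p⟩
  let u' : scale H' 1 := ⟨resolvent H' u, hH'.resolvent_mem_scale_one u⟩
  set Ap := (resolvent H ^ (1 / 2 : ℝ) : E →L[ℂ] E) p
  set Au := (resolvent H' ^ (1 / 2 : ℝ) : F →L[ℂ] F) u
  have hf' : (resolvent H ^ (1 / 2 : ℝ) : E →L[ℂ] E) Ap = f' := hH.rpow_half_apply p
  have hu' : (resolvent H' ^ (1 / 2 : ℝ) : F →L[ℂ] F) Au = u' := hH'.rpow_half_apply u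
  obtain ⟨a, ha⟩ := mem_scale_iff.mp (J₁ f').2
  obtain ⟨b, hb⟩ := mem_scale_iff.mp (J₁' u').2
  have hnf : scaleNorm H 1 f' ≤ ‖x‖ := by
    rw [hH.scaleNorm_eq zero_le_one f' hf']
    exact (hH.norm_rpow_apply_le hhalf p).trans hpx
  have hnu : scaleNorm H' 1 u' ≤ ‖u‖ := by
    rw [hH'.scaleNorm_eq zero_le_one u' hu']
    exact hH'.norm_rpow_apply_le hhalf u
  have hnu0 : 0 ≤ scaleNorm H' 1 u' := norm_nonneg _
  have hRp : ‖resolvent H p‖ ≤ ‖x‖ := by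
    have := hH.norm_rpow_apply_le zero_le_one p
    rw [CFC.rpow_one _ hH.resolvent_nonneg] at this
    exact this.trans hpx
  have hRu : ‖resolvent H' u‖ ≤ ‖u‖ := by
    have := hH'.norm_rpow_apply_le zero_le_one u
    rwa [CFC.rpow_one _ hH'.resolvent_nonneg] at this
  -- With resolvent images as arguments, the forms turn into plain inner products, `h(R p, ·) = ⟪p,
  -- ·⟫ - ⟪R p, ·⟫`.
  have form1 : form H' (J₁ f') u' = ⟪(J₁ f' : F), u⟫_ℂ - ⟪(J₁ f' : F), resolvent H' u⟫_ℂ := by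
    rw [hH'.form_apply _ _ ha hu', ← ha, inner_rpow_left _ _ a u]
  have form2 : form H f' (J₁' u') = ⟪p, (J₁' u' : E)⟫_ℂ - ⟪resolvent H p, (J₁' u' : E)⟫_ℂ := by
    rw [hH.form_apply _ _ hf' hb, ← hb, ← inner_rpow_left _ _ p b]
  have hcomm : ‖form H' (J₁ f') u' - form H f' (J₁' u')‖ ≤ δ * ‖x‖ * ‖u‖ := by
    refine (h.comm f' (mem_scale_iff.mpr ⟨y, hy⟩) u').trans ?_
    rw [hH.scaleNorm_eq (by linarith) _ hy]
    gcongr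
  have hJ : ‖J (resolvent H p) - (J₁ f' : F)‖ ≤ δ * ‖x‖ :=
    (h.scale_left f').trans (by gcongr)
  have hJ' : ‖J' (resolvent H' u) - (J₁' u' : E)‖ ≤ δ * ‖u‖ :=
    (h.scale_right u').trans (by gcongr)
  have hadj : ∀ g : E, ‖g‖ ≤ ‖x‖ →
      ‖⟪J g, resolvent H' u⟫_ℂ - ⟪g, J' (resolvent H' u)⟫_ℂ‖ ≤ δ * ‖x‖ * ‖u‖ := fun g hg => by
    rw [← ContinuousLinearMap.adjoint_inner_left J', ← inner_sub_left]
    refine (norm_inner_le_norm _ _).trans ?_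
    have h1 : ‖J g - ContinuousLinearMap.adjoint J' g‖ ≤ δ * ‖g‖ :=
      (J - ContinuousLinearMap.adjoint J').le_of_opNorm_le h.adj g
    have h2 : δ * ‖g‖ ≤ δ * ‖x‖ := by gcongr
    exact mul_le_mul (h1.trans h2) hRu (norm_nonneg _) (by positivity)
  have e1 : ‖⟪J (resolvent H p) - (J₁ f' : F), u⟫_ℂ‖ ≤ δ * ‖x‖ * ‖u‖ :=
    (norm_inner_le_norm _ _).trans (by gcongr)
  have e2 : ‖⟪J (resolvent H p) - (J₁ f' : F), resolvent H' u⟫_ℂ‖ ≤ δ * ‖x‖ * ‖u‖ :=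
    (norm_inner_le_norm _ _).trans (by gcongr)
  have e3 : ∀ g : E, ‖g‖ ≤ ‖x‖ →
      ‖⟪g, J' (resolvent H' u) - (J₁' u' : E)⟫_ℂ‖ ≤ δ * ‖x‖ * ‖u‖ := fun g hg => by
    refine (norm_inner_le_norm _ _).trans ?_
    calc ‖g‖ * ‖J' (resolvent H' u) - (J₁' u' : E)‖ ≤ ‖x‖ * (δ * ‖u‖) := by gcongr
      _ = δ * ‖x‖ * ‖u‖ := by ring
  have hsym : ⟪resolvent H' (J p), u⟫_ℂ = ⟪J p, resolvent H' u⟫_ℂ :=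
    hH'.isSelfAdjoint_resolvent.isSymmetric _ _
  -- Seven summands, each at most `δ ‖x‖ ‖u‖`: this is the constant `7`.
  have key : ⟪J (resolvent H p) - resolvent H' (J p), u⟫_ℂ =
      ⟪J (resolvent H p) - (J₁ f' : F), u⟫_ℂ
      + (form H' (J₁ f') u' - form H f' (J₁' u'))
      - ⟪J (resolvent H p) - (J₁ f' : F), resolvent H' u⟫_ℂ
      + (⟪J (resolvent H p), resolvent H' u⟫_ℂ - ⟪resolvent H p, J' (resolvent H' u)⟫_ℂ)
      + ⟪resolvent H p, J' (resolvent H' u) - (J₁' u' : E)⟫_ℂ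
      - (⟪J p, resolvent H' u⟫_ℂ - ⟪p, J' (resolvent H' u)⟫_ℂ)
      - ⟪p, J' (resolvent H' u) - (J₁' u' : E)⟫_ℂ := by
    rw [form1, form2]
    simp only [inner_sub_left, inner_sub_right, hsym]
    ring
  rw [key]
  have := hadj p hpx
  have := hadj _ hRp
  have := e3 p hpx
  have := e3 _ hRp
  refine (norm_sub_le _ _).trans ?_
  refine (add_le_add ((norm_sub_le _ _).trans (add_le_add ((norm_add_le _ _).trans (add_le_add
    ((norm_add_le _ _).trans (add_le_add ((norm_sub_le _ _).trans (add_le_add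
    (norm_add_le _ _) le_rfl)) le_rfl)) le_rfl)) le_rfl)) le_rfl).trans ?_
  linarith

/-! ### Continuous functions of almost intertwined operators -/

/-- Induction on monomials via `R'^(n+1) J - J R^(n+1) = R' (R'^n J - J R^n) + (R' J - J R) R^n`,
where `R^n` is moved past `P`. The constant depends on the polynomial alone. -/
theorem exists_norm_aeval_intertwine_le (p : Polynomial ℝ) : ∃ C : ℝ, 0 ≤ C ∧
    ∀ {E : Type u} [NormedAddCommGroup E] [InnerProductSpace ℂ E]
      {F : Type v} [NormedAddCommGroup F] [InnerProductSpace ℂ F]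
      {R P : E →L[ℂ] E} {R' : F →L[ℂ] F} {J : E →L[ℂ] F} {c : ℝ},
      ‖R‖ ≤ 1 → ‖R'‖ ≤ 1 → Commute R P → (∀ x, ‖(R' ∘L J - J ∘L R) (P x)‖ ≤ c * ‖x‖) →
      ∀ x, ‖(Polynomial.aeval R' p ∘L J - J ∘L Polynomial.aeval R p) (P x)‖ ≤ C * c * ‖x‖ := by
  induction p using Polynomial.induction_on with
  | C a =>
    refine ⟨0, le_rfl, fun {E} _ _ {F} _ _ {R P R' J c} _ _ _ _ x => ?_⟩
    simp [Algebra.algebraMap_eq_smul_one]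
  | add p q hp hq =>
    obtain ⟨C, hC, hp⟩ := hp
    obtain ⟨D, hD, hq⟩ := hq
    refine ⟨C + D, add_nonneg hC hD, fun {E} _ _ {F} _ _ {R P R' J c} h1 h2 h3 h4 x => ?_⟩
    have e : (Polynomial.aeval R' (p + q) ∘L J - J ∘L Polynomial.aeval R (p + q)) (P x) =
        (Polynomial.aeval R' p ∘L J - J ∘L Polynomial.aeval R p) (P x) +
        (Polynomial.aeval R' q ∘L J - J ∘L Polynomial.aeval R q) (P x) := by
      simp only [map_add, sub_apply, ContinuousLinearMap.comp_apply, add_apply]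
      abel
    rw [e, add_mul, add_mul]
    exact (norm_add_le _ _).trans (add_le_add (hp h1 h2 h3 h4 x) (hq h1 h2 h3 h4 x))
  | monomial n a h =>
    obtain ⟨C, hC, h⟩ := h
    refine ⟨C + |a|, by positivity, fun {E} _ _ {F} _ _ {R P R' J c} h1 h2 h3 h4 x => ?_⟩
    have hRx : ∀ n : ℕ, ∀ y, ‖(R ^ n) y‖ ≤ ‖y‖ := fun n y => by
      induction n with
      | zero => simp
      | succ n ih =>
        rw [pow_succ', mul_apply_eq_comp]
        exact ((R.le_of_opNorm_le h1 _).trans (by rw [one_mul])).trans ih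
    have hRn : ∀ n : ℕ, ∀ y, (R ^ n) (P y) = P ((R ^ n) y) := fun n y =>
      congrArg (fun A : E →L[ℂ] E => A y) (h3.pow_left n).eq
    have e : (Polynomial.aeval R' (Polynomial.C a * Polynomial.X ^ (n + 1)) ∘L J -
        J ∘L Polynomial.aeval R (Polynomial.C a * Polynomial.X ^ (n + 1))) (P x) =
        R' ((Polynomial.aeval R' (Polynomial.C a * Polynomial.X ^ n) ∘L J -
          J ∘L Polynomial.aeval R (Polynomial.C a * Polynomial.X ^ n)) (P x)) +
        a • (R' ∘L J - J ∘L R) (P ((R ^ n) x)) := by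
      simp only [map_mul, Polynomial.aeval_C, map_pow, Polynomial.aeval_X,
        Algebra.algebraMap_eq_smul_one, smul_mul_assoc, one_mul, sub_apply,
        ContinuousLinearMap.comp_apply, smul_apply, pow_succ', mul_apply_eq_comp, map_sub, ← hRn,
        smul_sub]
      have hs : ∀ (A : F →L[ℂ] F) y, A (a • y) = a • A y := fun A y => by
        rw [← Complex.coe_smul, map_smul, Complex.coe_smul]
      have hs' : ∀ y, J (a • y) = a • J y := fun y => by
        rw [← Complex.coe_smul, map_smul, Complex.coe_smul]
      simp only [hs, hs']
      abel
    rw [e, add_mul, add_mul]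
    refine (norm_add_le _ _).trans (add_le_add ?_ ?_)
    · refine (R'.le_of_opNorm_le h2 _).trans ?_
      rw [one_mul]
      exact h h1 h2 h3 h4 x
    · rw [norm_smul, Real.norm_eq_abs, mul_assoc]
      have hx := h4 ((R ^ n) x)
      gcongr
      refine hx.trans ?_
      -- The sign of `c` is not given; a vector with `‖x‖ ≠ 0` forces `c ≥ 0`.
      by_cases hx0 : ‖x‖ = 0
      · have : (R ^ n) x = 0 := norm_le_zero_iff.mp ((hRx n x).trans hx0.le)
        rw [this, norm_zero, hx0]
      · have hc : 0 ≤ c := by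
          have hx' := (norm_nonneg _).trans (h4 x)
          exact nonneg_of_mul_nonneg_left hx' (lt_of_le_of_ne (norm_nonneg _) (Ne.symm hx0))
        exact mul_le_mul_of_nonneg_left (hRx n x) hc

theorem norm_cfc_sub_aeval_le {R : E →L[ℂ] E} (hR : IsSelfAdjoint R)
    (hs : spectrum ℝ R ⊆ Icc 0 1) {g : ℝ → ℝ} (hg : Continuous g) {p : Polynomial ℝ} {ε : ℝ}
    (hε : 0 ≤ ε) (hp : ∀ t ∈ Icc (0 : ℝ) 1, |p.eval t - g t| < ε) :
    ‖cfc g R - Polynomial.aeval R p‖ ≤ ε := by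
  rw [← cfc_polynomial p R, ← cfc_sub _ _ R hg.continuousOn p.continuous.continuousOn]
  refine norm_cfc_le hε fun t ht => ?_
  rw [Real.norm_eq_abs, abs_sub_comm]
  exact (hp t (hs ht)).le

theorem exists_norm_cfc_intertwine_le {g : ℝ → ℝ} (hg : Continuous g) {ε : ℝ} (hε : 0 < ε) :
    ∃ C : ℝ, 0 ≤ C ∧
    ∀ {E : Type u} [NormedAddCommGroup E] [InnerProductSpace ℂ E] [CompleteSpace E]
      {F : Type v} [NormedAddCommGroup F] [InnerProductSpace ℂ F] [CompleteSpace F]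
      {R P : E →L[ℂ] E} {R' : F →L[ℂ] F} {J : E →L[ℂ] F} {c : ℝ},
      IsSelfAdjoint R → spectrum ℝ R ⊆ Icc 0 1 → IsSelfAdjoint R' → spectrum ℝ R' ⊆ Icc 0 1 →
      ‖R‖ ≤ 1 → ‖R'‖ ≤ 1 → ‖P‖ ≤ 1 → ‖J‖ ≤ 2 → Commute R P →
      (∀ x, ‖(R' ∘L J - J ∘L R) (P x)‖ ≤ c * ‖x‖) →
      ∀ x, ‖(cfc g R' ∘L J - J ∘L cfc g R) (P x)‖ ≤ (ε + C * c) * ‖x‖ := by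
  -- Each of the two replacement errors picks up `‖J‖ ≤ 2`, hence `ε / 4`.
  obtain ⟨p, hp⟩ := exists_polynomial_near_of_continuousOn 0 1 g hg.continuousOn (ε / 4)
    (by positivity)
  obtain ⟨C, hC, h⟩ := exists_norm_aeval_intertwine_le.{u, v} p
  refine ⟨C, hC, fun {E} _ _ _ {F} _ _ _ {R P R' J c} hR hs hR' hs' h1 h2 hP hJ hc hRJ x => ?_⟩
  have b := h h1 h2 hc hRJ x
  have n1 := norm_cfc_sub_aeval_le hR hs hg (by positivity) hp
  have n2 := norm_cfc_sub_aeval_le hR' hs' hg (by positivity) hp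
  have hPx : ‖P x‖ ≤ ‖x‖ := (P.le_of_opNorm_le hP x).trans (by rw [one_mul])
  have hJP : ‖J (P x)‖ ≤ 2 * ‖x‖ := (J.le_of_opNorm_le hJ _).trans (by gcongr)
  have e : (cfc g R' ∘L J - J ∘L cfc g R) (P x) =
      (Polynomial.aeval R' p ∘L J - J ∘L Polynomial.aeval R p) (P x) +
      (cfc g R' - Polynomial.aeval R' p) (J (P x)) -
      J ((cfc g R - Polynomial.aeval R p) (P x)) := by
    simp only [sub_apply, ContinuousLinearMap.comp_apply, map_sub]
    abel
  have b1 : ‖(cfc g R' - Polynomial.aeval R' p) (J (P x))‖ ≤ ε / 4 * (2 * ‖x‖) :=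
    (ContinuousLinearMap.le_of_opNorm_le _ n2 _).trans (by gcongr)
  have b2 : ‖J ((cfc g R - Polynomial.aeval R p) (P x))‖ ≤ 2 * (ε / 4 * ‖x‖) := by
    refine (J.le_of_opNorm_le hJ _).trans ?_
    gcongr
    exact (ContinuousLinearMap.le_of_opNorm_le _ n1 _).trans (by gcongr)
  rw [e]
  refine (norm_sub_le _ _).trans ((add_le_add_left (norm_add_le _ _) _).trans ?_)
  linarith

/-! ### Functions that are continuous on a spectrum -/

/-- The isometry turns a pointwise bound on the spectrum into a bound at each vector. The last term
is kept vectorwise because it is small only at particular `f`. -/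
theorem IsBorelCalc.norm_sub_le {R : E →L[ℂ] E} (hR : IsSelfAdjoint R)
    (hs : spectrum ℝ R ⊆ Icc 0 1) {φ g χ : ℝ → ℝ} {T : E →L[ℂ] E} (hT : IsBorelCalc R φ T)
    (hg : Continuous g) (hχ : Continuous χ) {ε : ℝ} (hε : 0 ≤ ε)
    (h : ∀ t ∈ Icc (0 : ℝ) 1, |g t - φ t| ≤ ε + χ t) (f : E) :
    ‖(cfc g R : E →L[ℂ] E) f - T f‖ ≤ ε * ‖f‖ + ‖(cfc χ R : E →L[ℂ] E) f‖ := by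
  have h1 : ‖(cfc g R : E →L[ℂ] E) f - T f‖ₑ ≤ ‖(cfc (fun t => ε + χ t) R : E →L[ℂ] E) f‖ₑ := by
    rw [hT f g hg, enorm_cfc_apply hR f (g := fun t => ε + χ t)
      (continuous_const.add hχ)]
    refine eLpNorm_mono_ae ((ae_mem_spectrum R f).mono fun t ht => ?_)
    exact (h t (hs ht)).trans (le_abs_self _)
  rw [← ofReal_norm, ← ofReal_norm, ENNReal.ofReal_le_ofReal_iff (norm_nonneg _)] at h1
  refine h1.trans ?_
  rw [cfc_add R (fun _ => ε) χ continuousOn_const hχ.continuousOn, cfc_const ε R,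
    Algebra.algebraMap_eq_smul_one, add_apply, smul_apply, one_apply_eq_self]
  refine (norm_add_le _ _).trans (add_le_add_left (le_of_eq ?_) _)
  rw [norm_smul, Real.norm_of_nonneg hε]

theorem IsBorelCalc.cfc_apply_eq {R : E →L[ℂ] E} {K : Set ℝ}
    (hs : spectrum ℝ R ⊆ K) {φ g : ℝ → ℝ} {T : E →L[ℂ] E} (hT : IsBorelCalc R φ T)
    (hg : Continuous g) (h : EqOn g φ K) (f : E) : (cfc g R : E →L[ℂ] E) f = T f := by
  have h1 := hT f g hg
  have h2 : eLpNorm (g - φ) 2 (cfcMeasure R f) = 0 := by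
    rw [eLpNorm_congr_ae (g := 0) ((ae_mem_spectrum R f).mono fun t ht => by
      simp [h (hs ht)]), eLpNorm_zero]
  rw [h2, enorm_eq_zero] at h1
  exact sub_eq_zero.mp h1

/-- `g` is a Tietze extension of `φ` from `K`. Near `K` it is `ε`-close to `φ`; on the compact rest
of `[0, 1]`, `√t dist(t, K)` has a positive minimum and absorbs the bounded difference. The factor
`√t` costs nothing as `0 ∈ K`. -/
theorem exists_continuous_near_of_continuousAt {φ : ℝ → ℝ} {K : Set ℝ} (hK : IsClosed K)
    (h0 : (0 : ℝ) ∈ K) {M : ℝ} (hM : ∀ t, |φ t| ≤ M) (hφ : ∀ t ∈ K, ContinuousAt φ t) {ε : ℝ}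
    (hε : 0 < ε) : ∃ g : ℝ → ℝ, Continuous g ∧ EqOn g φ K ∧ ∃ C : ℝ, 0 ≤ C ∧
      ∀ t ∈ Icc (0 : ℝ) 1, |g t - φ t| ≤ ε + C * (√t * Metric.infDist t K) := by
  have hφK : ContinuousOn φ K := fun t ht => (hφ t ht).continuousWithinAt
  obtain ⟨g, hg⟩ := ContinuousMap.exists_restrict_eq hK ⟨K.domRestrict φ, hφK.domRestrict⟩
  have hgφ : EqOn g φ K := fun t ht => congrArg (fun h : C(K, ℝ) => h ⟨t, ht⟩) hg
  refine ⟨g, g.continuous, hgφ, ?_⟩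
  -- The interior is taken because `φ` may be discontinuous off `K`; continuity at the points of `K`
  -- still puts `K` inside.
  let V : Set ℝ := interior {t | |g t - φ t| < ε}
  have hKV : K ⊆ V := fun t ht => by
    rw [mem_interior_iff_mem_nhds]
    have hc : ContinuousAt (fun t => |g t - φ t|) t :=
      (g.continuous.continuousAt.sub (hφ t ht)).abs
    exact hc.eventually_lt continuousAt_const (by simpa [hgφ ht] using hε)
  have hcomp : IsCompact (Icc (0 : ℝ) 1 \ V) := isCompact_Icc.diff isOpen_interior
  obtain ⟨B, hB⟩ := isCompact_Icc.exists_bound_of_continuousOn (s := Icc (0 : ℝ) 1)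
    g.continuous.continuousOn
  have hpos : ∀ t ∈ Icc (0 : ℝ) 1 \ V, 0 < √t * Metric.infDist t K := fun t ht => by
    have htK : t ∉ K := fun h => ht.2 (hKV h)
    have ht0 : t ≠ 0 := fun h => htK (h ▸ h0)
    exact mul_pos (Real.sqrt_pos.mpr (lt_of_le_of_ne ht.1.1 ht0.symm))
      ((hK.notMem_iff_infDist_pos ⟨0, h0⟩).mp htK)
  have hcont : Continuous fun t : ℝ => √t * Metric.infDist t K :=
    Real.continuous_sqrt.mul (Metric.continuous_infDist_pt K)
  obtain ⟨r, hr, hrt⟩ : ∃ r : ℝ, 0 < r ∧ ∀ t ∈ Icc (0 : ℝ) 1 \ V,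
      r ≤ √t * Metric.infDist t K := by
    rcases (Icc (0 : ℝ) 1 \ V).eq_empty_or_nonempty with he | hne
    · exact ⟨1, one_pos, fun t ht => by simp [he] at ht⟩
    · obtain ⟨s, hs, hmin⟩ := hcomp.exists_isMinOn hne hcont.continuousOn
      exact ⟨_, hpos s hs, fun t ht => hmin ht⟩
  have hM0 : 0 ≤ M := (abs_nonneg _).trans (hM 0)
  have hB0 : 0 ≤ B := (norm_nonneg _).trans (hB 0 (by simp))
  refine ⟨(B + M) / r, by positivity, fun t ht => ?_⟩
  have hnn : 0 ≤ √t * Metric.infDist t K := mul_nonneg (Real.sqrt_nonneg t) Metric.infDist_nonneg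
  by_cases htV : t ∈ V
  · have h1 : |g t - φ t| < ε := (interior_subset htV : t ∈ {t | |g t - φ t| < ε})
    have h2 : 0 ≤ (B + M) / r * (√t * Metric.infDist t K) := by positivity
    linarith
  · have h1 : |g t - φ t| ≤ B + M := (abs_sub _ _).trans (add_le_add (hB t ht) (hM t))
    have h2 : (B + M) / r * r ≤ (B + M) / r * (√t * Metric.infDist t K) := by
      gcongr
      exact hrt t ⟨ht, htV⟩
    rw [div_mul_cancel₀ _ hr.ne'] at h2
    linarith

theorem exists_norm_borelCalc_intertwine_le {φ : ℝ → ℝ} {K : Set ℝ} (hK : IsClosed K)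
    (h0 : (0 : ℝ) ∈ K) {M : ℝ} (hM : ∀ t, |φ t| ≤ M) (hφ : ∀ t ∈ K, ContinuousAt φ t) {ε : ℝ}
    (hε : 0 < ε) : ∃ C : ℝ, 0 ≤ C ∧
    ∀ {E : Type u} [NormedAddCommGroup E] [InnerProductSpace ℂ E] [CompleteSpace E]
      {F : Type v} [NormedAddCommGroup F] [InnerProductSpace ℂ F] [CompleteSpace F]
      {R P T : E →L[ℂ] E} {R' T' : F →L[ℂ] F} {J : E →L[ℂ] F} {J' : F →L[ℂ] E} {δ : ℝ},
      0 ≤ δ →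
      IsSelfAdjoint R → spectrum ℝ R ⊆ Icc 0 1 → IsSelfAdjoint R' → spectrum ℝ R' ⊆ Icc 0 1 →
      ‖R‖ ≤ 1 → ‖R'‖ ≤ 1 → ‖P‖ ≤ 1 → ‖J‖ ≤ 2 → ‖J'‖ ≤ 2 → Commute R P →
      (∀ x, ‖(R' ∘L J - J ∘L R) (P x)‖ ≤ 7 * δ * ‖x‖) →
      (∀ z, ‖(cfc Real.sqrt R : E →L[ℂ] E) z - J' (J ((cfc Real.sqrt R : E →L[ℂ] E) z))‖ ≤
        δ * ‖z‖) →
      IsBorelCalc R φ T → IsBorelCalc R' φ T' → (spectrum ℝ R ⊆ K ∨ spectrum ℝ R' ⊆ K) →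
      ∀ x, ‖(T' ∘L J - J ∘L T) (P x)‖ ≤ (ε + C * δ) * ‖x‖ := by
  have hε8 : 0 < ε / 8 := by positivity
  obtain ⟨g, hg, hgφ, C₀, hC₀, hgC⟩ := exists_continuous_near_of_continuousAt hK h0 hM hφ hε8
  set χ : ℝ → ℝ := fun t => C₀ * (√t * Metric.infDist t K) with hχdef
  have hχ : Continuous χ :=
    continuous_const.mul (Real.continuous_sqrt.mul (Metric.continuous_infDist_pt K))
  obtain ⟨C₁, hC₁, h₁⟩ := exists_norm_cfc_intertwine_le.{u, v} hg hε8
  obtain ⟨C₂, hC₂, h₂⟩ := exists_norm_cfc_intertwine_le.{u, v} hχ hε8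
  -- Dictated by the second case below: `28 = 7 · 2 · 2`, with one factor from `‖J‖` and one from
  -- `‖J'‖`. The first case needs less.
  refine ⟨7 * C₁ + 2 * C₀ + 28 * C₂, by positivity, ?_⟩
  intro E _ _ _ F _ _ _ R P T R' T' J J' δ hδ hR hs hR' hs' n1 n2 hP hJ hJ' hc hRJ hS hT hT' hK' x
  have b1 := h₁ hR hs hR' hs' n1 n2 hP hJ hc hRJ x
  have b2 := h₂ hR hs hR' hs' n1 n2 hP hJ hc hRJ x
  set y := P x
  have hy : ‖y‖ ≤ ‖x‖ := (P.le_of_opNorm_le hP x).trans (by rw [one_mul])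
  have hJy : ‖J y‖ ≤ 2 * ‖x‖ := (J.le_of_opNorm_le hJ _).trans (by gcongr)
  have e : (T' ∘L J - J ∘L T) y = (cfc g R' ∘L J - J ∘L cfc g R) y -
      ((cfc g R' : F →L[ℂ] F) (J y) - T' (J y)) + J ((cfc g R : E →L[ℂ] E) y - T y) := by
    simp only [sub_apply, ContinuousLinearMap.comp_apply, map_sub]
    abel
  have hχ0 : ∀ t ∈ K, χ t = (fun _ => (0 : ℝ)) t := fun t ht => by
    simp [hχdef, Metric.infDist_zero_of_mem ht]
  have hx0 := norm_nonneg x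
  rw [e]
  rcases hK' with hsK | hsK
  -- Here `χ(R) = 0`, so almost intertwining bounds `χ(R') J y` directly.
  · rw [hT.cfc_apply_eq hsK hg hgφ y, sub_self, map_zero, add_zero]
    have hχR : (cfc χ R : E →L[ℂ] E) = 0 := by
      rw [cfc_congr fun t ht => hχ0 t (hsK ht), cfc_const_zero]
    rw [hχR, ContinuousLinearMap.comp_zero, sub_zero, ContinuousLinearMap.comp_apply] at b2
    have b3 := hT'.norm_sub_le hR' hs' hg hχ hε8.le hgC (J y)
    have b4 : ε / 8 * ‖J y‖ ≤ ε / 8 * (2 * ‖x‖) := by gcongr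
    refine (_root_.norm_sub_le _ _).trans ?_
    have p1 : 0 ≤ C₀ * δ * ‖x‖ := by positivity
    have p2 : 0 ≤ C₂ * δ * ‖x‖ := by positivity
    have p3 : 0 ≤ ε * ‖x‖ := by positivity
    linarith
  · rw [hT'.cfc_apply_eq hsK hg hgφ (J y), sub_self, sub_zero]
    have hχR : (cfc χ R' : F →L[ℂ] F) = 0 := by
      rw [cfc_congr fun t ht => hχ0 t (hsK ht), cfc_const_zero]
    rw [hχR, ContinuousLinearMap.zero_comp, zero_sub, neg_apply, norm_neg,
      ContinuousLinearMap.comp_apply] at b2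
    have b3 := hT.norm_sub_le hR hs hg hχ hε8.le hgC y
    have b4 : ε / 8 * ‖y‖ ≤ ε / 8 * ‖x‖ := by gcongr
    have b5 : ‖J ((cfc g R : E →L[ℂ] E) y - T y)‖ ≤ 2 * ‖(cfc g R : E →L[ℂ] E) y - T y‖ :=
      J.le_of_opNorm_le hJ _
    set d : ℝ → ℝ := fun t => Metric.infDist t K
    have hd : Continuous d := Metric.continuous_infDist_pt K
    -- Here only `J χ(R) y` is known to be small. Splitting off `√R` puts `χ(R) y` where `J' J` is
    -- `δ`-close to the identity, so `J` can be undone.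
    have hχe : (cfc χ R : E →L[ℂ] E) y =
        (cfc Real.sqrt R : E →L[ℂ] E) ((C₀ • (cfc d R : E →L[ℂ] E)) y) := by
      rw [← cfc_smul C₀ d R hd.continuousOn]
      change _ = (cfc Real.sqrt R * cfc (fun t => C₀ • d t) R : E →L[ℂ] E) y
      rw [← cfc_mul Real.sqrt (fun t => C₀ • d t) R Real.continuous_sqrt.continuousOn
        (hd.const_smul C₀).continuousOn]
      congr 2
      ext t
      simp only [hχdef, d, smul_eq_mul]
      ring
    -- As `0 ∈ K`, `dist(t, K) ≤ t ≤ 1` on the spectrum.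
    have hdn : ‖(cfc d R : E →L[ℂ] E)‖ ≤ 1 := norm_cfc_le zero_le_one fun t ht => by
      have h1 := Metric.infDist_le_dist_of_mem (x := t) h0
      rw [Real.dist_eq, sub_zero, abs_of_nonneg (hs ht).1] at h1
      rw [Real.norm_of_nonneg Metric.infDist_nonneg]
      exact h1.trans (hs ht).2
    have b6 : ‖(cfc χ R : E →L[ℂ] E) y - J' (J ((cfc χ R : E →L[ℂ] E) y))‖ ≤ δ * (C₀ * ‖x‖) := by
      rw [hχe]
      refine (hS _).trans ?_
      rw [smul_apply, norm_smul, Real.norm_of_nonneg hC₀]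
      have : ‖(cfc d R : E →L[ℂ] E) y‖ ≤ ‖x‖ :=
        (ContinuousLinearMap.le_of_opNorm_le _ hdn y).trans (by rwa [one_mul])
      gcongr
    have b7 : ‖J' (J ((cfc χ R : E →L[ℂ] E) y))‖ ≤ 2 * ‖J ((cfc χ R : E →L[ℂ] E) y)‖ :=
      J'.le_of_opNorm_le hJ' _
    have b8 := norm_le_norm_sub_add ((cfc χ R : E →L[ℂ] E) y) (J' (J ((cfc χ R : E →L[ℂ] E) y)))
    refine (norm_add_le _ _).trans ?_
    have p2 : 0 ≤ C₂ * δ * ‖x‖ := by positivity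
    have p3 : 0 ≤ ε * ‖x‖ := by positivity
    linarith

/-! ### Transport of functions and spectra to the resolvent -/

/-- The function `ψ(1 / t - 1)` for `t > 0`, continued by the value `l` at infinity. -/
def resolventFun (ψ : ℝ≥0∞ → ℝ) (l : ℝ) : ℝ → ℝ :=
  (Ioi 0).piecewise (fun t => ψ (ENNReal.ofReal (t⁻¹ - 1))) fun _ => l

/-- The image of `S ∪ {∞}` under `s ↦ 1 / (s + 1)`. -/
def resolventSet (S : Set ℝ≥0) : Set ℝ :=
  {t | t ∈ Icc (0 : ℝ) 1 ∧ (t = 0 ∨ (t⁻¹ - 1).toNNReal ∈ S)}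

theorem resolventFun_of_pos (ψ : ℝ≥0∞ → ℝ) (l : ℝ) {t : ℝ} (ht : 0 < t) :
    resolventFun ψ l t = ψ (ENNReal.ofReal (t⁻¹ - 1)) :=
  piecewise_eq_of_mem _ _ _ ht

theorem resolventFun_of_nonpos (ψ : ℝ≥0∞ → ℝ) (l : ℝ) {t : ℝ} (ht : t ≤ 0) :
    resolventFun ψ l t = l :=
  piecewise_eq_of_notMem _ _ _ (not_lt.mpr ht)

theorem measurable_resolventFun {ψ : ℝ≥0∞ → ℝ} (hψ : Measurable ψ) (l : ℝ) :
    Measurable (resolventFun ψ l) :=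
  Measurable.piecewise measurableSet_Ioi
    (hψ.comp (ENNReal.measurable_ofReal.comp (measurable_inv.sub_const 1))) measurable_const

theorem abs_resolventFun_le {ψ : ℝ≥0∞ → ℝ} {l M : ℝ} (hψ : ∀ x, |ψ x| ≤ M) (hl : |l| ≤ M)
    (t : ℝ) : |resolventFun ψ l t| ≤ M := by
  rcases lt_or_ge 0 t with h | h
  · rw [resolventFun_of_pos ψ l h]
    exact hψ _
  · rwa [resolventFun_of_nonpos ψ l h]

theorem continuousAt_inv_sub_one {t : ℝ} (ht : 0 < t) : ContinuousAt (fun t : ℝ => t⁻¹ - 1) t :=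
  (continuousAt_inv₀ ht.ne').sub continuousAt_const

/-- At `t = 0`, the left side is constant and the right side is the limit of `ψ` at infinity; the
value `ψ ∞` plays no role. -/
theorem continuousAt_resolventFun {ψ : ℝ≥0∞ → ℝ} {l : ℝ} {S : Set ℝ≥0}
    (hψ : ∀ x ∈ S, ContinuousAt ψ x) (hl : Tendsto (fun x : ℝ≥0 => ψ x) atTop (𝓝 l)) {t : ℝ}
    (ht : t ∈ resolventSet S) : ContinuousAt (resolventFun ψ l) t := by
  rcases ht.1.1.eq_or_lt with h0 | h0
  · rw [← h0, ContinuousAt, resolventFun_of_nonpos ψ l le_rfl, ← nhdsLE_sup_nhdsGT]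
    refine Tendsto.sup ?_ ?_
    · exact tendsto_const_nhds.congr' (eventually_nhdsWithin_of_forall fun t ht =>
        (resolventFun_of_nonpos ψ l ht).symm)
    · have h1 : Tendsto (fun t : ℝ => t⁻¹ - 1) (𝓝[>] 0) atTop :=
        tendsto_atTop_add_const_right _ (-1) tendsto_inv_nhdsGT_zero
      exact (hl.comp (tendsto_real_toNNReal_atTop.comp h1)).congr'
        (eventually_nhdsWithin_of_forall fun t ht => (resolventFun_of_pos ψ l ht).symm)
  · have hS : (t⁻¹ - 1).toNNReal ∈ S := ht.2.resolve_left h0.ne'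
    have h1 : ContinuousAt (fun t : ℝ => ψ (ENNReal.ofReal (t⁻¹ - 1))) t := by
      have h2 : ContinuousAt (fun t : ℝ => ENNReal.ofReal (t⁻¹ - 1)) t :=
        ENNReal.continuous_ofReal.continuousAt.comp (continuousAt_inv_sub_one h0)
      exact ContinuousAt.comp (f := fun t : ℝ => ENNReal.ofReal (t⁻¹ - 1)) (hψ _ hS) h2
    exact h1.congr ((lt_mem_nhds h0).mono fun s hs => (resolventFun_of_pos ψ l hs).symm)

theorem zero_mem_resolventSet (S : Set ℝ≥0) : (0 : ℝ) ∈ resolventSet S :=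
  ⟨⟨le_rfl, zero_le_one⟩, Or.inl rfl⟩

theorem isClosed_resolventSet {S : Set ℝ≥0} (hS : IsClosed S) : IsClosed (resolventSet S) := by
  rw [← isOpen_compl_iff, isOpen_iff_mem_nhds]
  intro t ht
  by_cases hI : t ∈ Icc (0 : ℝ) 1
  · have h0 : t ≠ 0 := fun h => ht ⟨hI, Or.inl h⟩
    have htS : (t⁻¹ - 1).toNNReal ∈ Sᶜ := fun h => ht ⟨hI, Or.inr h⟩
    have hc : ContinuousAt (fun t : ℝ => (t⁻¹ - 1).toNNReal) t :=
      continuous_real_toNNReal.continuousAt.comp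
        (continuousAt_inv_sub_one (lt_of_le_of_ne hI.1 h0.symm))
    filter_upwards [hc.preimage_mem_nhds (hS.isOpen_compl.mem_nhds htS),
      isOpen_ne.mem_nhds h0] with s hs hs0 h
    exact hs (h.2.resolve_left hs0)
  · filter_upwards [isClosed_Icc.isOpen_compl.mem_nhds hI] with s hs h using hs h.1

/-- Non-zero points come from spectral mapping; `0`, which may be spectral for unbounded `H`, is in
the target by construction. -/
theorem SpecIn.spectrum_resolvent_subset {H : E →ₗ.[ℂ] E} (hH : IsNonnegSelfAdjoint H)
    {S : Set ℝ≥0} (h : SpecIn H S) : spectrum ℝ (resolvent H) ⊆ resolventSet S := fun t ht => by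
  refine ⟨hH.spectrum_resolvent_subset_Icc ht, or_iff_not_imp_left.mpr fun h0 => ?_⟩
  obtain ⟨s, hs, hst⟩ := h (hH.inv_sub_one_mem_spec ht h0)
  have e : (s : ℝ) = t⁻¹ - 1 := Complex.ofReal_injective hst
  rwa [← e, Real.toNNReal_coe]

theorem IsNonnegSelfAdjoint.cfc_sqrt_resolvent {H : E →ₗ.[ℂ] E} (hH : IsNonnegSelfAdjoint H) :
    cfc Real.sqrt (resolvent H) = (resolvent H ^ (1 / 2 : ℝ) : E →L[ℂ] E) := by
  rw [CFC.rpow_eq_cfc_real hH.resolvent_nonneg]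
  exact cfc_congr fun t _ => Real.sqrt_eq_rpow t

/-- Real and imaginary parts are treated separately with `ε / 2` each. `C` is fixed before the
spaces and operators, which gives uniformity. -/
theorem exists_normLE_borelFun {ψ : ℝ≥0∞ → ℂ} {S : Set ℝ≥0} (hψ : Measurable ψ) {M : ℝ}
    (hM : ∀ x, ‖ψ x‖ ≤ M) (hψS : ∀ x ∈ S, ContinuousAt ψ x) {l : ℂ}
    (hl : Tendsto (fun x : ℝ≥0 => ψ x) atTop (𝓝 l)) (hS : IsClosed S) {ε : ℝ} (hε : 0 < ε) :
    ∃ C : ℝ, 0 ≤ C ∧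
      ∀ (E : Type u) [NormedAddCommGroup E] [InnerProductSpace ℂ E] [CompleteSpace E]
        (F : Type v) [NormedAddCommGroup F] [InnerProductSpace ℂ F] [CompleteSpace F]
        (δ k : ℝ) (H : E →ₗ.[ℂ] E) (H' : F →ₗ.[ℂ] F)
        (J : E →L[ℂ] F) (J₁ : scale H 1 →ₗ[ℂ] scale H' 1)
        (J' : F →L[ℂ] E) (J₁' : scale H' 1 →ₗ[ℂ] scale H 1),
        0 < δ → 1 ≤ k → IsNonnegSelfAdjoint H → IsNonnegSelfAdjoint H' →
        IsClose δ k H H' J J₁ J' J₁' → (SpecIn H S ∨ SpecIn H' S) →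
        NormLE H (max 0 (k - 2)) (borelFun ψ H' ∘L J - J ∘L borelFun ψ H) (ε + C * δ) := by
  have hlM : ‖l‖ ≤ M := le_of_tendsto hl.norm (Eventually.of_forall fun x => hM x)
  set φ₁ := resolventFun (fun x => (ψ x).re) l.re
  set φ₂ := resolventFun (fun x => (ψ x).im) l.im
  have hm₁ : Measurable φ₁ := measurable_resolventFun (Complex.measurable_re.comp hψ) _
  have hm₂ : Measurable φ₂ := measurable_resolventFun (Complex.measurable_im.comp hψ) _
  have hb₁ : ∀ t, |φ₁ t| ≤ M := abs_resolventFun_le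
    (fun x => (Complex.abs_re_le_norm _).trans (hM x)) ((Complex.abs_re_le_norm _).trans hlM)
  have hb₂ : ∀ t, |φ₂ t| ≤ M := abs_resolventFun_le
    (fun x => (Complex.abs_im_le_norm _).trans (hM x)) ((Complex.abs_im_le_norm _).trans hlM)
  have hc₁ : ∀ t ∈ resolventSet S, ContinuousAt φ₁ t := fun t => continuousAt_resolventFun
    (fun x hx => Complex.continuous_re.continuousAt.comp (hψS x hx))
    ((Complex.continuous_re.tendsto l).comp hl)
  have hc₂ : ∀ t ∈ resolventSet S, ContinuousAt φ₂ t := fun t => continuousAt_resolventFun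
    (fun x hx => Complex.continuous_im.continuousAt.comp (hψS x hx))
    ((Complex.continuous_im.tendsto l).comp hl)
  have hK := isClosed_resolventSet hS
  have h0 := zero_mem_resolventSet S
  obtain ⟨C₁, hC₁, h₁⟩ := exists_norm_borelCalc_intertwine_le.{u, v} hK h0 hb₁ hc₁ (half_pos hε)
  obtain ⟨C₂, hC₂, h₂⟩ := exists_norm_borelCalc_intertwine_le.{u, v} hK h0 hb₂ hc₂ (half_pos hε)
  refine ⟨C₁ + C₂, add_nonneg hC₁ hC₂, ?_⟩
  intro E _ _ _ F _ _ _ δ k H H' J J₁ J' J₁' hδ hk hH hH' h hSp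
  have hR := hH.isSelfAdjoint_resolvent
  have hR' := hH'.isSelfAdjoint_resolvent
  obtain ⟨T₁, hT₁⟩ := exists_isBorelCalc hR hm₁ hb₁
  obtain ⟨T₂, hT₂⟩ := exists_isBorelCalc hR hm₂ hb₂
  obtain ⟨T₁', hT₁'⟩ := exists_isBorelCalc hR' hm₁ hb₁
  obtain ⟨T₂', hT₂'⟩ := exists_isBorelCalc hR' hm₂ hb₂
  have e₁ : ∀ t : ℝ, 0 < t → φ₁ t = (ψ (ENNReal.ofReal (t⁻¹ - 1))).re := fun t =>
    resolventFun_of_pos _ _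
  have e₂ : ∀ t : ℝ, 0 < t → φ₂ t = (ψ (ENNReal.ofReal (t⁻¹ - 1))).im := fun t =>
    resolventFun_of_pos _ _
  rw [hH.borelFun_eq hψ hm₁ hm₂ hb₁ hb₂ e₁ e₂ hT₁ hT₂,
    hH'.borelFun_eq hψ hm₁ hm₂ hb₁ hb₂ e₁ e₂ hT₁' hT₂']
  have hm0 : 0 ≤ max 0 (k - 2) := le_max_left _ _
  have hcomm : Commute (resolvent H) (resolvent H ^ (max 0 (k - 2) / 2) : E →L[ℂ] E) := by
    have := hH.commute_cfc_rpow id (max 0 (k - 2) / 2)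
    rwa [cfc_id ℝ (resolvent H)] at this
  have hRJ := h.norm_resolvent_sub_le hδ hk hH hH'
  have hsq : ∀ z, ‖(cfc Real.sqrt (resolvent H) : E →L[ℂ] E) z -
      J' (J ((cfc Real.sqrt (resolvent H) : E →L[ℂ] E) z))‖ ≤ δ * ‖z‖ := by
    rw [hH.cfc_sqrt_resolvent]
    exact (hH.normLE_iff zero_le_one _ _).mp h.inv_left
  have hSp' : spectrum ℝ (resolvent H) ⊆ resolventSet S ∨
      spectrum ℝ (resolvent H') ⊆ resolventSet S :=
    hSp.imp (fun h => h.spectrum_resolvent_subset hH) fun h => h.spectrum_resolvent_subset hH'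
  rw [hH.normLE_iff hm0]
  intro x
  have b₁ := h₁ hδ.le hR hH.spectrum_resolvent_subset_Icc hR' hH'.spectrum_resolvent_subset_Icc
    hH.norm_resolvent_le hH'.norm_resolvent_le (hH.norm_rpow_le_one (by positivity)) h.bdd_left
    h.bdd_right hcomm hRJ hsq hT₁ hT₁' hSp' x
  have b₂ := h₂ hδ.le hR hH.spectrum_resolvent_subset_Icc hR' hH'.spectrum_resolvent_subset_Icc
    hH.norm_resolvent_le hH'.norm_resolvent_le (hH.norm_rpow_le_one (by positivity)) h.bdd_left
    h.bdd_right hcomm hRJ hsq hT₂ hT₂' hSp' x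
  set y := (resolvent H ^ (max 0 (k - 2) / 2) : E →L[ℂ] E) x
  have e : ((T₁' + Complex.I • T₂') ∘L J - J ∘L (T₁ + Complex.I • T₂)) y =
      (T₁' ∘L J - J ∘L T₁) y + Complex.I • (T₂' ∘L J - J ∘L T₂) y := by
    simp only [sub_apply, ContinuousLinearMap.comp_apply, add_apply, smul_apply, map_add, map_smul,
      smul_sub]
    abel
  rw [e]
  refine (norm_add_le _ _).trans ?_
  rw [norm_smul, Complex.norm_I, one_mul]
  linarith

/-! ### From bounds `ε + C δ` to a rate function -/

/-- `η δ` is the infimum of the admissible non-negative bounds. It tends to `0` because every `ε + C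
δ` is admissible, and `hcl` makes the infimum itself admissible. -/
theorem exists_rate {Q : ℝ → ℝ → Prop}
    (hQ : ∀ ε : ℝ, 0 < ε → ∃ C : ℝ, 0 ≤ C ∧ ∀ δ : ℝ, 0 < δ → Q δ (ε + C * δ))
    (hcl : ∀ δ a : ℝ, (∀ e : ℝ, 0 < e → ∃ c, c < a + e ∧ Q δ c) → Q δ a) :
    ∃ η : ℝ → ℝ, Tendsto η (𝓝[>] 0) (𝓝 0) ∧ ∀ δ : ℝ, 0 < δ → Q δ (η δ) := by
  have hbdd : ∀ δ, BddBelow {c : ℝ | 0 ≤ c ∧ Q δ c} := fun δ => ⟨0, fun c hc => hc.1⟩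
  refine ⟨fun δ => sInf {c : ℝ | 0 ≤ c ∧ Q δ c}, ?_, fun δ hδ => ?_⟩
  · refine Metric.tendsto_nhds.mpr fun ε hε => ?_
    obtain ⟨C, hC, h⟩ := hQ (ε / 2) (half_pos hε)
    have hr : 0 < ε / 2 / (C + 1) := by positivity
    filter_upwards [Ioo_mem_nhdsGT hr] with δ hδ
    have h1 : sInf {c : ℝ | 0 ≤ c ∧ Q δ c} ≤ ε / 2 + C * δ :=
      csInf_le (hbdd δ) ⟨by have := hδ.1; positivity, h δ hδ.1⟩
    have h2 : 0 ≤ sInf {c : ℝ | 0 ≤ c ∧ Q δ c} := Real.sInf_nonneg fun c hc => hc.1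
    have h3 := (lt_div_iff₀ (by positivity : 0 < C + 1)).mp hδ.2
    rw [Real.dist_eq, sub_zero, abs_of_nonneg h2]
    have := hδ.1
    linarith
  · obtain ⟨C, hC, h⟩ := hQ 1 one_pos
    refine hcl δ _ fun e he => ?_
    obtain ⟨c, hc, hlt⟩ := exists_lt_of_csInf_lt
      (⟨1 + C * δ, by positivity, h δ hδ⟩ : {c : ℝ | 0 ≤ c ∧ Q δ c}.Nonempty)
      (lt_add_of_pos_right _ he)
    exact ⟨c, hlt, hc.2⟩

theorem normLE_of_forall_pos {H : E →ₗ.[ℂ] E} {m a : ℝ} {A : E →L[ℂ] F}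
    (h : ∀ e : ℝ, 0 < e → ∃ c, c < a + e ∧ NormLE H m A c) : NormLE H m A a := by
  intro f
  have hN : 0 ≤ scaleNorm H m f := norm_nonneg _
  refine le_of_forall_pos_le_add fun e he => ?_
  obtain ⟨c, hc, hA⟩ := h (e / (scaleNorm H m f + 1)) (by positivity)
  calc ‖A f‖ ≤ c * scaleNorm H m f := hA f
    _ ≤ (a + e / (scaleNorm H m f + 1)) * scaleNorm H m f := by gcongr
    _ = a * scaleNorm H m f + e * (scaleNorm H m f / (scaleNorm H m f + 1)) := by ring
    _ ≤ a * scaleNorm H m f + e * 1 := by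
      gcongr
      rw [div_le_one (by positivity)]
      linarith
    _ = a * scaleNorm H m f + e := by rw [mul_one]

theorem exists_rate_borelFun {ψ : ℝ≥0∞ → ℂ} {S : Set ℝ≥0} (hψ : Measurable ψ)
    (hM : ∃ M : ℝ, ∀ x, ‖ψ x‖ ≤ M) (hψS : ∀ x ∈ S, ContinuousAt ψ x)
    (hl : ∃ l : ℂ, Tendsto (fun x : ℝ≥0 => ψ x) atTop (𝓝 l)) (hS : IsClosed S) :
    ∃ η : ℝ → ℝ, Tendsto η (𝓝[>] 0) (𝓝 0) ∧
      ∀ (E : Type u) [NormedAddCommGroup E] [InnerProductSpace ℂ E] [CompleteSpace E]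
        (F : Type v) [NormedAddCommGroup F] [InnerProductSpace ℂ F] [CompleteSpace F]
        (δ k : ℝ) (H : E →ₗ.[ℂ] E) (H' : F →ₗ.[ℂ] F)
        (J : E →L[ℂ] F) (J₁ : scale H 1 →ₗ[ℂ] scale H' 1)
        (J' : F →L[ℂ] E) (J₁' : scale H' 1 →ₗ[ℂ] scale H 1),
        0 < δ → 1 ≤ k → IsNonnegSelfAdjoint H → IsNonnegSelfAdjoint H' →
        IsClose δ k H H' J J₁ J' J₁' → (SpecIn H S ∨ SpecIn H' S) →
        NormLE H (max 0 (k - 2)) (borelFun ψ H' ∘L J - J ∘L borelFun ψ H) (η δ) := by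
  obtain ⟨M, hM⟩ := hM
  obtain ⟨l, hl⟩ := hl
  -- All spaces and operators are quantified inside `Q`, so that one `η` serves them all.
  let Q : ℝ → ℝ → Prop := fun δ c =>
      ∀ (E : Type u) [NormedAddCommGroup E] [InnerProductSpace ℂ E] [CompleteSpace E]
        (F : Type v) [NormedAddCommGroup F] [InnerProductSpace ℂ F] [CompleteSpace F]
        (k : ℝ) (H : E →ₗ.[ℂ] E) (H' : F →ₗ.[ℂ] F)
        (J : E →L[ℂ] F) (J₁ : scale H 1 →ₗ[ℂ] scale H' 1)
        (J' : F →L[ℂ] E) (J₁' : scale H' 1 →ₗ[ℂ] scale H 1),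
        1 ≤ k → IsNonnegSelfAdjoint H → IsNonnegSelfAdjoint H' →
        IsClose δ k H H' J J₁ J' J₁' → (SpecIn H S ∨ SpecIn H' S) →
        NormLE H (max 0 (k - 2)) (borelFun ψ H' ∘L J - J ∘L borelFun ψ H) c
  obtain ⟨η, hη, h⟩ := exists_rate (Q := Q)
    (fun ε hε => by
      obtain ⟨C, hC, h⟩ := exists_normLE_borelFun.{u, v} hψ hM hψS hl hS hε
      refine ⟨C, hC, fun δ hδ => ?_⟩
      intro E _ _ _ F _ _ _ k H H' J J₁ J' J₁'
      exact h E F δ k H H' J J₁ J' J₁' hδ)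
    (fun δ a h => by
      intro E _ _ _ F _ _ _ k H H' J J₁ J' J₁' hk hH hH' hc hSp
      refine normLE_of_forall_pos fun e he => ?_
      obtain ⟨c, hlt, hQ⟩ := h e he
      exact ⟨c, hlt, hQ E F k H H' J J₁ J' J₁' hk hH hH' hc hSp⟩)
  refine ⟨η, hη, ?_⟩
  intro E _ _ _ F _ _ _ δ k H H' J J₁ J' J₁' hδ
  exact h δ hδ E F k H H' J J₁ J' J₁'

/-! ### Indicator functions of intervals -/

/-- The embedding into `[0, ∞]` is open, so continuity can be tested on `[0, ∞)`, where the
indicator is locally constant off the frontier. -/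
theorem continuousAt_indicator_coe {I : Set ℝ≥0} {x : ℝ≥0} (hx : x ∉ frontier I) :
    ContinuousAt (((↑) '' I : Set ℝ≥0∞).indicator (1 : ℝ≥0∞ → ℂ)) x := by
  have ho : IsOpenEmbedding ((↑) : ℝ≥0 → ℝ≥0∞) := ENNReal.isOpenEmbedding_coe
  rw [← ho.continuousAt_iff]
  have e : (((↑) '' I : Set ℝ≥0∞).indicator (1 : ℝ≥0∞ → ℂ)) ∘ ((↑) : ℝ≥0 → ℝ≥0∞) =
      I.indicator fun _ => (1 : ℂ) := by
    ext y
    by_cases hy : y ∈ I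
    · simp [hy]
    · simp [hy]
  rw [e]
  by_cases hi : x ∈ interior I
  · refine continuousAt_const.congr (f := fun _ => (1 : ℂ)) ?_
    filter_upwards [mem_interior_iff_mem_nhds.mp hi] with y hy
    simp [hy]
  · have hc : x ∉ closure I := fun h => hx ⟨h, hi⟩
    refine continuousAt_const.congr (f := fun _ => (0 : ℂ)) ?_
    filter_upwards [isClosed_closure.isOpen_compl.mem_nhds hc] with y hy
    have : y ∉ I := fun h => hy (subset_closure h)
    simp [this]

/-- A bounded interval is eventually left, an unbounded one never left once entered. -/
theorem exists_tendsto_indicator_coe {I : Set ℝ≥0} (hI : I.OrdConnected) :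
    ∃ l : ℂ, Tendsto (fun x : ℝ≥0 => ((↑) '' I : Set ℝ≥0∞).indicator (1 : ℝ≥0∞ → ℂ) x) atTop
      (𝓝 l) := by
  by_cases hb : BddAbove I
  · obtain ⟨b, hb⟩ := hb
    refine ⟨0, tendsto_const_nhds.congr' ?_⟩
    filter_upwards [eventually_gt_atTop b] with x hx
    have : x ∉ I := fun h => hx.not_ge (hb h)
    simp [this]
  · rw [not_bddAbove_iff] at hb
    obtain ⟨a, ha, -⟩ := hb 0
    refine ⟨1, tendsto_const_nhds.congr' ?_⟩
    filter_upwards [eventually_ge_atTop a] with x hx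
    obtain ⟨b, hb, hxb⟩ := hb x
    have : x ∈ I := hI.out ha hb ⟨hx, hxb.le⟩
    simp [this]

end QuasiUnitary

end

theorem mainTheorem6 :
    -- functions that are continuous at the points of a set containing one of the two spectra
    (∀ (ψ : ℝ≥0∞ → ℂ) (U : Set ℝ≥0∞) (S : Set ℝ≥0),
      Measurable ψ → (∃ C : ℝ, ∀ x, ‖ψ x‖ ≤ C) → (∀ x ∈ U, ContinuousAt ψ x) →
      (∃ l : ℂ, Tendsto (fun x : ℝ≥0 => ψ x) atTop (𝓝 l)) →
      IsClosed S → (∀ x ∈ S, (x : ℝ≥0∞) ∈ U) →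
      ∃ η : ℝ → ℝ, Tendsto η (𝓝[>] 0) (𝓝 0) ∧
        ∀ (E : Type u) [NormedAddCommGroup E] [InnerProductSpace ℂ E] [CompleteSpace E]
          (F : Type v) [NormedAddCommGroup F] [InnerProductSpace ℂ F] [CompleteSpace F]
          (δ k : ℝ) (H : E →ₗ.[ℂ] E) (H' : F →ₗ.[ℂ] F)
          (J : E →L[ℂ] F) (J₁ : scale H 1 →ₗ[ℂ] scale H' 1)
          (J' : F →L[ℂ] E) (J₁' : scale H' 1 →ₗ[ℂ] scale H 1),
          0 < δ → 1 ≤ k → IsNonnegSelfAdjoint H → IsNonnegSelfAdjoint H' →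
          IsClose δ k H H' J J₁ J' J₁' → (SpecIn H S ∨ SpecIn H' S) →
          NormLE H (max 0 (k - 2)) (borelFun ψ H' ∘L J - J ∘L borelFun ψ H) (η δ)) ∧
    -- spectral projections of an interval whose boundary avoids one of the two spectra
    (∀ (I S : Set ℝ≥0), I.OrdConnected → IsClosed S → Disjoint (frontier I) S →
      ∃ η : ℝ → ℝ, Tendsto η (𝓝[>] 0) (𝓝 0) ∧
        ∀ (E : Type u) [NormedAddCommGroup E] [InnerProductSpace ℂ E] [CompleteSpace E]
          (F : Type v) [NormedAddCommGroup F] [InnerProductSpace ℂ F] [CompleteSpace F]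
          (δ k : ℝ) (H : E →ₗ.[ℂ] E) (H' : F →ₗ.[ℂ] F)
          (J : E →L[ℂ] F) (J₁ : scale H 1 →ₗ[ℂ] scale H' 1)
          (J' : F →L[ℂ] E) (J₁' : scale H' 1 →ₗ[ℂ] scale H 1),
          0 < δ → 1 ≤ k → IsNonnegSelfAdjoint H → IsNonnegSelfAdjoint H' →
          IsClose δ k H H' J J₁ J' J₁' → (SpecIn H S ∨ SpecIn H' S) →
          NormLE H (max 0 (k - 2))
            (borelFun (((↑) '' I : Set ℝ≥0∞).indicator 1) H' ∘L J -
              J ∘L borelFun (((↑) '' I : Set ℝ≥0∞).indicator 1) H) (η δ)) := by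
  refine ⟨fun ψ U S hψ hM hU hl hS hSU =>
    exists_rate_borelFun hψ hM (fun x hx => hU x (hSU x hx)) hl hS, fun I S hI hS hd => ?_⟩
  refine exists_rate_borelFun ?_ ⟨1, fun x => ?_⟩ (fun x hx => ?_)
    (exists_tendsto_indicator_coe hI) hS
  · exact measurable_one.indicator
      (ENNReal.isOpenEmbedding_coe.measurableEmbedding.measurableSet_image.mpr hI.measurableSet)
  · exact (norm_indicator_le_norm_self _ _).trans (by simp)
  · exact continuousAt_indicator_coe fun h => Set.disjoint_left.mp hd h hx
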